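/- Let $(X,Y)$ be a random pair with values in $\mathbb R^d\times\{\pm1\}$ and class prior $\pi=\Pr(Y=+1)\in(0,1)$. Let $p$ be the law of $X$ and $p_\pm$ the conditional law of $X$ given $Y=\pm1$. Let $\ell:\mathbb R\times\{\pm1\}\to[0,\infty)$ be a nonnegative loss such that $\ell(t,+1)+\ell(t,-1)=1$ for all $t$ and $t\mapsto\ell(t,y)$ is $L$-Lipschitz for each $y$, and put $R(g)=\mathbb E[\ell(g(X),Y)]$. Given mutually independent i.i.d. samples $x^+_1,\dots,x^+_{n_+}\sim p_+$, $x^-_1,\dots,x^-_{n_-}\sim p_-$ and $x^u_1,\dots,x^u_{n_u}\sim p$ (with $n_+,n_-,n_u\ge1$), define the empirical risks $$\widehat R_{PN}(g)=\frac{\pi}{n_+}\sum_i\ell(g(x^+_i),+1)+\frac{1-\pi}{n_-}\sum_j\ell(g(x^-_j),-1),$$ $$\widehat R_{PU}(g)=-\pi+\frac{2\pi}{n_+}\sum_i\ell(g(x^+_i),+1)+\frac1{n_u}\sum_j\ell(g(x^u_j),-1),$$ $$\widehat R_{NU}(g)=-(1-\pi)+\frac1{n_u}\sum_i\ell(g(x^u_i),+1)+\frac{2(1-\pi)}{n_-}\sum_j\ell(g(x^-_j),-1).$$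 Let $\mathcal G$ be a class of measurable functions $\mathbb R^d\to\mathbb R$ such that for all $n$ and all open $U\subseteq\mathbb R^n$ the set $\{(x_1,\dots,x_n):\exists g\in\mathcal G,\ (g(x_1),\dots,g(x_n))\in U\}$ is measurable (so that suprema over $\mathcal G$ are measurable). For a law $q$ let $$\mathfrak R_{n,q}(\mathcal G)=\mathbb E_{x_1,\dots,x_n\sim q}\,\mathbb E_\sigma\Big[\sup_{g\in\mathcal G}\frac1n\sum_{i=1}^n\sigma_i g(x_i)\Big]$$ be the Rademacher complexity, where the $x_i$ are i.i.d. and $\sigma$ is uniform on $\{\pm1\}^n$. Let $g^*$ be any minimizer of $R$ over $\mathcal G$, and let $\hat g_{PN},\hat g_{PU},\hat g_{NU}$ be arbitrary global minimizers over $\mathcal G$ of $\widehat R_{PN},\widehat R_{PU},\widehat R_{NU}$. (a) Assume that there is a constant $C_{\mathcal G}>0$ with $\mathfrak R_{n,q}(\mathcal G)\le C_{\mathcal G}/\sqrt n$ for all $n\ge1$ and all $q\in\{p,p_+,p_-\}$, and let $f(\delta)=4LC_{\mathcal G}+\sqrt{2\ln(4/\delta)}$ (the square root being read as $0$ if $\delta>4$).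 Then for every $\delta>0$ each of the following three bounds holds, separately, with probability at least $1-\delta$ over the samples used for training: $$R(\hat g_{PN})-R(g^*)\le f(\delta)\Big(\frac{\pi}{\sqrt{n_+}}+\frac{1-\pi}{\sqrt{n_-}}\Big),$$ $$R(\hat g_{PU})-R(g^*)\le f(\delta)\Big(\frac{2\pi}{\sqrt{n_+}}+\frac1{\sqrt{n_u}}\Big),$$ $$R(\hat g_{NU})-R(g^*)\le f(\delta)\Big(\frac1{\sqrt{n_u}}+\frac{2(1-\pi)}{\sqrt{n_-}}\Big).$$ (b) Let $\mathcal H$ be a real Hilbert space, $C_w,C_\phi>0$, and $\phi:\mathbb R^d\to\mathcal H$ a strongly measurable feature map with $\|\phi(x)\|\le C_\phi$ for all $x$. Then the class $\mathcal G=\{x\mapsto\langle w,\phi(x)\rangle:\ w\in\mathcal H,\ \|w\|\le C_w\}$ satisfies $\mathfrak R_{n,q}(\mathcal G)\le C_wC_\phi/\sqrt n$ for all $n\ge1$ and $q\in\{p,p_+,p_-\}$, and the three bounds of (a) hold for it with $C_{\mathcal G}=C_wC_\phi$. -/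

import Mathlib

open MeasureTheory
open scoped ENNReal NNReal

universe u

noncomputable section

namespace PUComparison

/-- The input space `ℝ^d`. -/
abbrev Input (d : ℕ) : Type := EuclideanSpace ℝ (Fin d)

/-- The label set `{+1, -1}`, realized as the units of `ℤ`. -/
abbrev Label : Type := ℤˣ

/-- Every set of labels is measurable. -/
instance : DiscreteMeasurableSpace Label where
  forall_measurableSet U :=
    ⟨(fun u : ℤˣ => (u : ℤ)) '' U, trivial, Set.preimage_image_eq U Units.val_injective⟩

variable {d : ℕ}

/-! ### The data distribution -/

/-- The class prior `π = P(Y = +1)`. -/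
def classPrior (P : Measure (Input d × Label)) : ℝ := P.real {z | z.2 = 1}

/-- The law `p` of the input `X`. -/
def marginal (P : Measure (Input d × Label)) : Measure (Input d) := P.map Prod.fst

/-- The law of the input `X` conditionally on `Y = y`: this is `p₊` for `y = 1` and `p₋` for
`y = -1`. -/
def condMarginal (P : Measure (Input d × Label)) (y : Label) : Measure (Input d) :=
  (ProbabilityTheory.cond P {z | z.2 = y}).map Prod.fst

/-- The set `{p, p₊, p₋}`. -/
def marginals (P : Measure (Input d × Label)) : Set (Measure (Input d)) :=
  {marginal P, condMarginal P 1, condMarginal P (-1)}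

/-- The law `q^n` of a sample of `n` independent points drawn from `q`. -/
def sampleLaw (q : Measure (Input d)) (n : ℕ) : Measure (Fin n → Input d) :=
  Measure.pi fun _ => q

/-! ### Risks and empirical risks -/

/-- The risk `R(g) = E[ℓ(g(X), Y)]`. -/
def risk (P : Measure (Input d × Label)) (ℓ : ℝ → Label → ℝ) (g : Input d → ℝ) : ℝ :=
  ∫ z, ℓ (g z.1) z.2 ∂P

/-- The empirical average `(1/n) ∑ᵢ ℓ(g(xᵢ), y)`. -/
def empAvg {n : ℕ} (ℓ : ℝ → Label → ℝ) (y : Label) (x : Fin n → Input d) (g : Input d → ℝ) : ℝ :=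
  (1 / (n : ℝ)) * ∑ i, ℓ (g (x i)) y

/-- The PN risk estimator, with class prior `prior`. -/
def empRiskPN {nP nN : ℕ} (prior : ℝ) (ℓ : ℝ → Label → ℝ)
    (xP : Fin nP → Input d) (xN : Fin nN → Input d) (g : Input d → ℝ) : ℝ :=
  prior * empAvg ℓ 1 xP g + (1 - prior) * empAvg ℓ (-1) xN g

/-- The PU risk estimator, with class prior `prior`. -/
def empRiskPU {nP nU : ℕ} (prior : ℝ) (ℓ : ℝ → Label → ℝ)
    (xP : Fin nP → Input d) (xU : Fin nU → Input d) (g : Input d → ℝ) : ℝ :=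
  -prior + 2 * prior * empAvg ℓ 1 xP g + empAvg ℓ (-1) xU g

/-- The NU risk estimator, with class prior `prior`. -/
def empRiskNU {nU nN : ℕ} (prior : ℝ) (ℓ : ℝ → Label → ℝ)
    (xU : Fin nU → Input d) (xN : Fin nN → Input d) (g : Input d → ℝ) : ℝ :=
  -(1 - prior) + empAvg ℓ 1 xU g + 2 * (1 - prior) * empAvg ℓ (-1) xN g

/-- `g` is a global minimizer of `F` over the class `G`. -/
def IsArgmin (F : (Input d → ℝ) → ℝ) (G : Set (Input d → ℝ)) (g : Input d → ℝ) : Prop :=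
  g ∈ G ∧ ∀ g' ∈ G, F g ≤ F g'

/-! ### Function classes and Rademacher complexity -/

/-- The measurability needed for suprema over `G` to be random variables: every member of `G` is
measurable, and so is, for every open `U ⊆ ℝⁿ`, the event that some `g ∈ G` satisfies
`(g(x₁), …, g(xₙ)) ∈ U`.  The second condition says exactly that
`(x₁, …, xₙ) ↦ sup_{g ∈ G} F(g(x₁), …, g(xₙ))` is measurable for every continuous `F`. -/
structure MeasurableClass (G : Set (Input d → ℝ)) : Prop where
  measurable_mem : ∀ g ∈ G, Measurable g
  measurableSet_hit : ∀ (n : ℕ) (U : Set (Fin n → ℝ)), IsOpen U →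
    MeasurableSet {x : Fin n → Input d | ∃ g ∈ G, (fun i => g (x i)) ∈ U}

/-- The empirical Rademacher complexity
`E_σ [sup_{g ∈ G} (1/n) ∑ᵢ σᵢ g(xᵢ)]`, with `σ` uniform on `{±1}ⁿ`, as an extended real number
(the supremum may be infinite). -/
def empRademacher {n : ℕ} (G : Set (Input d → ℝ)) (x : Fin n → Input d) : EReal :=
  ((1 / 2 ^ n : ℝ) : EReal) * ∑ σ : Fin n → Label,
    ⨆ g ∈ G, (((1 / (n : ℝ)) * ∑ i, ((σ i : ℤ) : ℝ) * g (x i) : ℝ) : EReal)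

/-- The Rademacher complexity of `G` for samples of size `n` from `q`, as an element of `[0, ∞]`.
The empirical complexity of a nonempty class is nonnegative (see `empRademacher_nonneg`), so
`EReal.toENNReal` only changes its type. -/
def rademacher (n : ℕ) (q : Measure (Input d)) (G : Set (Input d → ℝ)) : ℝ≥0∞ :=
  ∫⁻ x, (empRademacher G x).toENNReal ∂(sampleLaw q n)

/-- The assumption `R_{n,q}(G) ≤ C / √n` for all sample sizes `n` and all `q ∈ {p, p₊, p₋}`. -/
def RademacherCondition (P : Measure (Input d × Label)) (G : Set (Input d → ℝ)) (C : ℝ) : Prop :=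
  ∀ n : ℕ, 0 < n → ∀ q ∈ marginals P, rademacher n q G ≤ ENNReal.ofReal (C / √n)

/-- Hyperplanes with bounded normals in the feature space: all `x ↦ ⟨w, φ(x)⟩` with
`‖w‖ ≤ Cw`. -/
def hyperplaneClass {H : Type u} [NormedAddCommGroup H] [InnerProductSpace ℝ H]
    (φ : Input d → H) (Cw : ℝ) : Set (Input d → ℝ) :=
  {g | ∃ w : H, ‖w‖ ≤ Cw ∧ g = fun x => inner ℝ w (φ x)}

/-! ### The estimation error bounds -/

/-- "`A` holds with probability at least `r`". As `A` is not required to be measurable, this asks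
for a measurable event inside `A` whose probability is at least `r`. -/
def HoldsWithProb {Ω : Type*} [MeasurableSpace Ω] (μ : Measure Ω) (r : ℝ) (A : Set Ω) : Prop :=
  ∃ E : Set Ω, E ⊆ A ∧ MeasurableSet E ∧ ENNReal.ofReal r ≤ μ E

/-- `f(δ) = 4 L C + √(2 ln(4/δ))`. -/
def fDelta (L C δ : ℝ) : ℝ := 4 * L * C + √(2 * Real.log (4 / δ))

/-- The three estimation error bounds over the class `G` with Rademacher constant `C`, each holding
with probability at least `1 - δ` over the independent samples used for training, for all sample
sizes and all `δ > 0`. Each bound holds for arbitrary global minimizers of the empirical risk. -/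
def EstimationErrorBounds (P : Measure (Input d × Label)) (ℓ : ℝ → Label → ℝ) (L : ℝ)
    (G : Set (Input d → ℝ)) (C : ℝ) : Prop :=
  ∀ nP nN nU : ℕ, 0 < nP → 0 < nN → 0 < nU → ∀ δ : ℝ, 0 < δ →
  ∀ gstar : Input d → ℝ, IsArgmin (risk P ℓ) G gstar →
    HoldsWithProb ((sampleLaw (condMarginal P 1) nP).prod (sampleLaw (condMarginal P (-1)) nN))
      (1 - δ)
      {s | ∀ ghat, IsArgmin (empRiskPN (classPrior P) ℓ s.1 s.2) G ghat →
        risk P ℓ ghat - risk P ℓ gstar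
          ≤ fDelta L C δ * (classPrior P / √nP + (1 - classPrior P) / √nN)} ∧
    HoldsWithProb ((sampleLaw (condMarginal P 1) nP).prod (sampleLaw (marginal P) nU))
      (1 - δ)
      {s | ∀ ghat, IsArgmin (empRiskPU (classPrior P) ℓ s.1 s.2) G ghat →
        risk P ℓ ghat - risk P ℓ gstar
          ≤ fDelta L C δ * (2 * classPrior P / √nP + 1 / √nU)} ∧
    HoldsWithProb ((sampleLaw (marginal P) nU).prod (sampleLaw (condMarginal P (-1)) nN))
      (1 - δ)
      {s | ∀ ghat, IsArgmin (empRiskNU (classPrior P) ℓ s.1 s.2) G ghat →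
        risk P ℓ ghat - risk P ℓ gstar
          ≤ fDelta L C δ * (1 / √nU + 2 * (1 - classPrior P) / √nN)}

theorem empRademacher_nonneg {n : ℕ} {G : Set (Input d → ℝ)} (hG : G.Nonempty)
    (x : Fin n → Input d) : 0 ≤ empRademacher G x := by
  obtain ⟨g, hg⟩ := hG
  have hs : ∀ i : Fin n, ∑ σ : Fin n → Label, ((σ i : ℤ) : ℝ) = 0 := by
    intro i
    have h : ∑ σ : Fin n → Label, ((σ i : ℤ) : ℝ) = ∑ σ : Fin n → Label, -((σ i : ℤ) : ℝ) :=
      Fintype.sum_equiv (Equiv.neg _) _ _ (fun σ => by simp)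
    rw [Finset.sum_neg_distrib] at h
    linarith
  have h0 : ∑ σ : Fin n → Label, (1 / (n : ℝ)) * ∑ i, ((σ i : ℤ) : ℝ) * g (x i) = 0 := by
    rw [← Finset.mul_sum, Finset.sum_comm]
    simp [← Finset.sum_mul, hs]
  refine mul_nonneg (by positivity) ?_
  calc (0 : EReal)
      = ((∑ σ : Fin n → Label, (1 / (n : ℝ)) * ∑ i, ((σ i : ℤ) : ℝ) * g (x i) : ℝ) : EReal) := by
        rw [h0]; rfl
    _ = ∑ σ : Fin n → Label, (((1 / (n : ℝ)) * ∑ i, ((σ i : ℤ) : ℝ) * g (x i) : ℝ) : EReal) :=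
        map_sum (⟨⟨Real.toEReal, rfl⟩, EReal.coe_add⟩ : ℝ →+ EReal) _ _
    _ ≤ _ := Finset.sum_le_sum fun σ _ =>
        le_iSup₂ (f := fun g (_ : g ∈ G) =>
          (((1 / (n : ℝ)) * ∑ i, ((σ i : ℤ) : ℝ) * g (x i) : ℝ) : EReal)) g hg

end PUComparison

end

/-! All three empirical risks have the form `c + a * (average over sample 1) + b * (average over
sample 2)` and are unbiased for the risk: PN by conditioning on the label, PU and NU because `ℓ t 1
+ ℓ t (-1) = 1` lets the marginal stand in for the missing class. A minimizer `ĝ` of the empirical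
risk does not exceed `g*` there, so its excess risk is at most the difference between `ĝ` and `g*`
of (risk minus empirical risk). This splits into one weighted deviation per sample, so a uniform
one-sample bound (`exists_event_uniform_deviation`) suffices, and independence combines two of them
(`holdsWithProb_two_sample`).

For one sample, `deviation` treats `ĝ` and `g*` together. The population mean of the varying
function is replaced by the average over a ghost sample, so that the supremum involves finitely many
values of `g` and is measurable. Changing one sample point raises this functional by at most `2/n`,
and McDiarmid's inequality gives the tail `exp(-nε²/2)`. Its mean is at most `2LC/√n`, by
symmetrization and the contraction principle. With failure probability `δ/4` this fits inside
`f(δ)/√n`.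

For hyperplanes, the Cauchy–Schwarz inequality and the orthogonality of random signs bound the
complexity, and a countable family of normals gives measurability. -/

noncomputable section

namespace PUComparison

variable {d : ℕ}

/-! ### McDiarmid's inequality -/

section McDiarmid

open ProbabilityTheory

variable {X : Type*} [MeasurableSpace X]

theorem integral_pi_succ (q : Measure X) [IsProbabilityMeasure q] {n : ℕ}
    {F : (Fin (n + 1) → X) → ℝ} (hF : Integrable F (Measure.pi fun _ => q)) :
    ∫ x, F x ∂(Measure.pi fun _ => q) =
      ∫ a, ∫ y, F (Fin.cons a y) ∂(Measure.pi fun _ : Fin n => q) ∂q := by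
  have hmp := (measurePreserving_piFinSuccAbove (fun _ : Fin (n + 1) => q) 0).symm
  have h1 := hmp.integral_comp' (g := F)
  rw [← h1, integral_prod]
  · simp [MeasurableEquiv.piFinSuccAbove, Fin.consEquiv]
  · exact (hmp.integrable_comp_emb (MeasurableEquiv.measurableEmbedding _)).2 hF

theorem integrable_of_abs_le {Ω : Type*} [MeasurableSpace Ω] {μ : Measure Ω} [IsFiniteMeasure μ]
    {F : Ω → ℝ} (hF : Measurable F) {B : ℝ} (hB : ∀ x, |F x| ≤ B) : Integrable F μ :=
  .of_bound hF.aestronglyMeasurable B (.of_forall hB)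

theorem measurable_finCons {n : ℕ} :
    Measurable fun p : X × (Fin n → X) => (Fin.cons p.1 p.2 : Fin (n + 1) → X) := by
  refine measurable_pi_lambda _ fun i => ?_
  refine Fin.cases ?_ (fun j => ?_) i
  · simpa using measurable_fst
  · simp only [Fin.cons_succ]
    exact (measurable_pi_apply j).comp measurable_snd

/-- McDiarmid's bounded differences inequality, in moment generating function form. -/
theorem hasSubgaussianMGF_of_boundedDiff (q : Measure X) [IsProbabilityMeasure q] (c : ℝ≥0)
    {B : ℝ} (n : ℕ) (F : (Fin n → X) → ℝ) (hF : Measurable F) (hB : ∀ x, |F x| ≤ B)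
    (hdiff : ∀ x i v, F (Function.update x i v) - F x ≤ c) :
    HasSubgaussianMGF (fun x => F x - ∫ y, F y ∂(Measure.pi fun _ => q)) (n * (c / 2) ^ 2)
      (Measure.pi fun _ => q) := by
  induction n with
  | zero =>
    have : ∀ x, F x - ∫ y, F y ∂(Measure.pi fun _ : Fin 0 => q) = 0 := by
      intro x
      have : F = fun _ => F x := funext fun y => by rw [Subsingleton.elim y x]
      rw [this]; simp
    simp only [this]
    simp [HasSubgaussianMGF.fun_zero]
  | succ n ih =>
    set μ : Measure (Fin n → X) := Measure.pi fun _ => q with hμ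
    set K : X → (Fin n → X) → ℝ := fun a y => F (Fin.cons a y) with hK
    have hKm : Measurable (Function.uncurry K) := hF.comp measurable_finCons
    have hKm' : ∀ a, Measurable (K a) := fun a => hKm.comp measurable_prodMk_left
    have hKi : ∀ a, Integrable (K a) μ := fun a => integrable_of_abs_le (hKm' a) fun y => hB _
    set J : X → ℝ := fun a => ∫ y, K a y ∂μ with hJ
    have hJm : Measurable J :=
      (StronglyMeasurable.integral_prod_right hKm.stronglyMeasurable).measurable
    have hJdiff : ∀ a b, J a - J b ≤ c := by
      intro a b
      rw [hJ, ← integral_sub (hKi a) (hKi b)]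
      calc _ ≤ ∫ _, (c : ℝ) ∂μ := by
            refine integral_mono ((hKi a).sub (hKi b)) (integrable_const _) fun y => ?_
            have := hdiff (Fin.cons b y) 0 a
            rwa [Fin.update_cons_zero] at this
        _ = c := by simp
    have hne : Nonempty X := nonempty_of_isProbabilityMeasure q
    have hJB : ∀ a, |J a| ≤ B := fun a => by
      refine (norm_integral_le_of_norm_le_const (f := K a) (C := B) (.of_forall fun y => hB _)).trans ?_
      simp
    have hbdd : BddBelow (Set.range J) := ⟨-B, by rintro _ ⟨a, rfl⟩; exact (abs_le.1 (hJB a)).1⟩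
    -- The conditional mean given the first coordinate ranges over an interval of length `c`, so
    -- Hoeffding's lemma contributes `(c / 2) ^ 2`.
    have hJIcc : ∀ a, J a ∈ Set.Icc (⨅ b, J b) ((⨅ b, J b) + c) := fun a =>
      ⟨ciInf_le hbdd a, by
        have : J a - c ≤ ⨅ b, J b := le_ciInf fun b => by linarith [hJdiff a b]
        linarith⟩
    have hHoeff := hasSubgaussianMGF_of_mem_Icc (μ := q) hJm.aemeasurable (.of_forall hJIcc)
    have hFi : Integrable F (Measure.pi fun _ => q) := integrable_of_abs_le hF hB
    have hmean : ∫ x, F x ∂(Measure.pi fun _ => q) = ∫ a, J a ∂q := integral_pi_succ q hFi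
    set m := ∫ a, J a ∂q with hm
    have hmem : ∀ x, F x ∈ Set.Icc (-B) B := fun x => abs_le.1 (hB x)
    have hexp : ∀ t, Integrable (fun x => Real.exp (t * (F x - m))) (Measure.pi fun _ => q) :=
      fun t => integrable_exp_mul_of_mem_Icc (a := -B - m) (b := B - m)
        (hF.sub_const _).aemeasurable
        (.of_forall fun x => ⟨by linarith [(hmem x).1], by linarith [(hmem x).2]⟩)
    rw [hmean]
    refine ⟨hexp, fun t => ?_⟩
    rw [mgf, integral_pi_succ q (hexp t)]
    -- Martingale splitting `F - m = (K a y - J a) + (J a - m)`: with `a` fixed, the induction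
    -- hypothesis controls the first part.
    have hin : ∀ a, ∫ y, Real.exp (t * (F (Fin.cons a y) - m)) ∂μ ≤
        Real.exp ((n * (c / 2) ^ 2 : ℝ≥0) * t ^ 2 / 2) * Real.exp (t * (J a - m)) := by
      intro a
      have h1 : ∀ y, Real.exp (t * (F (Fin.cons a y) - m)) =
          Real.exp (t * (K a y - J a)) * Real.exp (t * (J a - m)) := fun y => by
        rw [← Real.exp_add]; congr 1; simp only [hK]; ring
      simp_rw [h1]
      rw [integral_mul_const]
      refine mul_le_mul_of_nonneg_right ?_ (Real.exp_nonneg _)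
      refine (ih (K a) (hKm' a) (fun y => hB _) fun y i v => ?_).mgf_le t
      have := hdiff (Fin.cons a y) i.succ v
      rwa [← Fin.cons_update] at this
    have hI := hHoeff.integrable_exp_mul t
    calc _ ≤ ∫ a, Real.exp ((n * (c / 2) ^ 2 : ℝ≥0) * t ^ 2 / 2) * Real.exp (t * (J a - m)) ∂q := by
          refine integral_mono_of_nonneg (.of_forall fun a => integral_nonneg fun y =>
            Real.exp_nonneg _) (hI.const_mul _) (.of_forall hin)
      _ = Real.exp ((n * (c / 2) ^ 2 : ℝ≥0) * t ^ 2 / 2) * mgf (fun a => J a - m) q t := by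
          rw [integral_const_mul]; rfl
      _ ≤ Real.exp ((n * (c / 2) ^ 2 : ℝ≥0) * t ^ 2 / 2) *
          Real.exp (((‖(⨅ b, J b) + c - ⨅ b, J b‖₊ / 2) ^ 2 : ℝ≥0) * t ^ 2 / 2) :=
          mul_le_mul_of_nonneg_left (hHoeff.mgf_le t) (Real.exp_nonneg _)
      _ = _ := by
          rw [← Real.exp_add]; congr 1
          simp
          ring

end McDiarmid

/-! ### The contraction principle for random signs -/

section Contraction

theorem sum_label (f : Label → ℝ) : ∑ s, f s = f 1 + f (-1) := by
  rw [show (Finset.univ : Finset Label) = {1, -1} from rfl, Finset.sum_pair (by decide)]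

theorem sum_finSucc_label {n : ℕ} (f : (Fin (n + 1) → Label) → ℝ) :
    ∑ σ, f σ = ∑ s : Label, ∑ σ : Fin n → Label, f (Fin.cons s σ) := by
  rw [← Fintype.sum_prod_type', ← (Fin.consEquiv fun _ : Fin (n + 1) => Label).sum_comp]
  rfl

/-- `u` is bounded, as a real function. -/
def AbsBdd {ι : Type*} (u : ι → ℝ) : Prop := ∃ B, ∀ g, |u g| ≤ B

theorem AbsBdd.bddAbove {ι : Type*} {u : ι → ℝ} (h : AbsBdd u) : BddAbove (Set.range u) := by
  obtain ⟨B, hB⟩ := h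
  exact ⟨B, by rintro _ ⟨g, rfl⟩; exact (abs_le.1 (hB g)).2⟩

theorem AbsBdd.add {ι : Type*} {u v : ι → ℝ} (hu : AbsBdd u) (hv : AbsBdd v) :
    AbsBdd fun g => u g + v g := by
  obtain ⟨B, hB⟩ := hu
  obtain ⟨C, hC⟩ := hv
  exact ⟨B + C, fun g => (abs_add_le _ _).trans (add_le_add (hB g) (hC g))⟩

theorem AbsBdd.const_mul {ι : Type*} {u : ι → ℝ} (hu : AbsBdd u) (c : ℝ) :
    AbsBdd fun g => c * u g := by
  obtain ⟨B, hB⟩ := hu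
  exact ⟨|c| * B, fun g => by rw [abs_mul]; exact mul_le_mul_of_nonneg_left (hB g) (abs_nonneg _)⟩

theorem AbsBdd.sum {ι κ : Type*} {u : κ → ι → ℝ} (s : Finset κ) (hu : ∀ i, AbsBdd (u i)) :
    AbsBdd fun g => ∑ i ∈ s, u i g := by
  choose B hB using hu
  exact ⟨∑ i ∈ s, B i, fun g => (Finset.abs_sum_le_sum_abs _ _).trans
    (Finset.sum_le_sum fun i _ => hB i g)⟩

/-- For a pair `g, h`, the left side contributes `v g + v h + (a g - a h)`, at most `v g + v h + |b
g - b h|`. The sign of `b g - b h` decides which of the two goes into the `+` supremum on the right.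
Boundedness matters because an unbounded real supremum is `0`. -/
theorem iSup_add_iSup_sub_le {ι : Type*} [Nonempty ι] {v a b : ι → ℝ} (hv : AbsBdd v)
    (hb : AbsBdd b) (hab : ∀ g h, |a g - a h| ≤ |b g - b h|) :
    (⨆ g, (v g + a g)) + ⨆ g, (v g - a g) ≤ (⨆ g, (v g + b g)) + ⨆ g, (v g - b g) := by
  have h1 : BddAbove (Set.range fun g => v g + b g) := (hv.add hb).bddAbove
  have h2 : BddAbove (Set.range fun g => v g - b g) := by
    simpa [sub_eq_add_neg] using (hv.add (hb.const_mul (-1))).bddAbove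
  have key : ∀ g h, v g + a g + (v h - a h) ≤ (⨆ g, (v g + b g)) + ⨆ g, (v g - b g) := by
    intro g h
    have e1 := le_ciSup h1 g
    have e2 := le_ciSup h2 h
    have e3 := le_ciSup h1 h
    have e4 := le_ciSup h2 g
    have e5 := (le_abs_self _).trans (hab g h)
    rcases abs_cases (b g - b h) with ⟨e, _⟩ | ⟨e, _⟩ <;> linarith
  have : ∀ g, v g + a g ≤ (⨆ g, (v g + b g)) + (⨆ g, (v g - b g)) - ⨆ g, (v g - a g) := by
    intro g
    have : (⨆ h, (v h - a h)) ≤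
        (⨆ g, (v g + b g)) + (⨆ g, (v g - b g)) - (v g + a g) :=
      ciSup_le fun h => by linarith [key g h]
    linarith
  linarith [ciSup_le this]

/-- The Ledoux–Talagrand contraction principle. -/
theorem sum_iSup_contraction {ι : Type*} [Nonempty ι] {n : ℕ} (a b : Fin n → ι → ℝ)
    (ha : ∀ i, AbsBdd (a i)) (hb : ∀ i, AbsBdd (b i))
    (hab : ∀ i g h, |a i g - a i h| ≤ |b i g - b i h|) (u : ι → ℝ) (hu : AbsBdd u) :
    ∑ σ : Fin n → Label, ⨆ g, (u g + ∑ i, ((σ i : ℤ) : ℝ) * a i g) ≤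
      ∑ σ : Fin n → Label, ⨆ g, (u g + ∑ i, ((σ i : ℤ) : ℝ) * b i g) := by
  induction n generalizing u with
  | zero => simp
  | succ n ih =>
    rw [sum_finSucc_label, sum_finSucc_label]
    simp only [Fin.sum_univ_succ, Fin.cons_zero, Fin.cons_succ, ← add_assoc]
    -- The offset `u` absorbs the signed term of coordinate `0`, so the induction hypothesis
    -- replaces all others; coordinate `0` is then the two-sign comparison above.
    calc _ ≤ ∑ s : Label, ∑ σ : Fin n → Label,
          ⨆ g, (u g + ((s : ℤ) : ℝ) * a 0 g + ∑ i, ((σ i : ℤ) : ℝ) * b i.succ g) :=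
          Finset.sum_le_sum fun s _ => ih _ _ (fun i => ha i.succ) (fun i => hb i.succ)
            (fun i => hab i.succ) _ (hu.add ((ha 0).const_mul _))
      _ ≤ _ := by
          rw [Finset.sum_comm, Finset.sum_comm (s := Finset.univ (α := Label))]
          refine Finset.sum_le_sum fun σ _ => ?_
          have hv : AbsBdd fun g => u g + ∑ i, ((σ i : ℤ) : ℝ) * b i.succ g :=
            hu.add (AbsBdd.sum _ fun i => (hb i.succ).const_mul _)
          have := iSup_add_iSup_sub_le hv (hb 0) (hab 0)
          rw [sum_label, sum_label]
          refine (le_of_eq ?_).trans (this.trans (le_of_eq ?_)) <;> congr 1 <;>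
            refine iSup_congr fun g => ?_ <;> simp <;> ring

end Contraction

/-! ### Measurability of suprema over the class -/

section Measurability

variable {G : Set (Input d → ℝ)}

/-- The supremum exceeds `a` exactly when some `g` sends the sample into the open set `{F > a}`. A
general finite index `κ` allows a sample together with its ghost. -/
theorem MeasurableClass.measurable_iSup [Nonempty G] (hG : MeasurableClass G) {κ : Type*}
    [Fintype κ] {F : (κ → ℝ) → ℝ} (hF : Continuous F) {B : ℝ} (hB : ∀ v, |F v| ≤ B) :
    Measurable fun x : κ → Input d => ⨆ g : G, F fun i => g.1 (x i) := by
  refine measurable_of_Ioi fun a => ?_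
  let e := Fintype.equivFin κ
  have hU : IsOpen {v : Fin (Fintype.card κ) → ℝ | a < F fun i => v (e i)} :=
    isOpen_lt continuous_const (hF.comp (by fun_prop))
  have hm : Measurable fun (x : κ → Input d) (j : Fin (Fintype.card κ)) => x (e.symm j) := by
    fun_prop
  convert hm (hG.measurableSet_hit _ _ hU) using 1
  ext x
  have hb : AbsBdd fun g : G => F fun i => g.1 (x i) := ⟨B, fun g => hB _⟩
  simp [lt_ciSup_iff hb.bddAbove]

end Measurability

/-! ### Rademacher complexity: from extended to real values, and contraction -/

section Rademacher

variable {G : Set (Input d → ℝ)}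

/-- The real-valued empirical Rademacher complexity of `{h ∘ g : g ∈ G}`. -/
def compRademacher (G : Set (Input d → ℝ)) (h : ℝ → ℝ) {n : ℕ} (x : Fin n → Input d) : ℝ :=
  (1 / 2 ^ n : ℝ) * ∑ σ : Fin n → Label, ⨆ g : G, (1 / (n : ℝ)) * ∑ i, ((σ i : ℤ) : ℝ) * h (g.1 (x i))

theorem EReal.sum_ne_bot {κ : Type*} (s : Finset κ) {f : κ → EReal} (hf : ∀ i, f i ≠ ⊥) :
    ∑ i ∈ s, f i ≠ ⊥ := by
  classical
  induction s using Finset.induction_on with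
  | empty => simp
  | insert a s ha ih => rw [Finset.sum_insert ha]; exact EReal.add_ne_bot_iff.2 ⟨hf a, ih⟩

theorem EReal.coe_finset_sum {κ : Type*} (s : Finset κ) (f : κ → ℝ) :
    ((∑ i ∈ s, f i : ℝ) : EReal) = ∑ i ∈ s, (f i : EReal) :=
  map_sum (⟨⟨Real.toEReal, rfl⟩, EReal.coe_add⟩ : ℝ →+ EReal) _ _

/-- In `EReal`, `⊤ + ⊥ = ⊥`; a summand `⊤` forces the sum to be `⊤` only because no summand is `⊥`.
-/
theorem EReal.ne_top_of_sum_ne_top {κ : Type*} (s : Finset κ) {f : κ → EReal}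
    (hf : ∀ i, f i ≠ ⊥) (hs : ∑ i ∈ s, f i ≠ ⊤) {i : κ} (hi : i ∈ s) : f i ≠ ⊤ := by
  classical
  intro h
  apply hs
  rw [← Finset.add_sum_erase s f hi, h]
  exact EReal.top_add_of_ne_bot (EReal.sum_ne_bot _ hf)

/-- If the empirical Rademacher complexity is finite, then it is a real average of real suprema. -/
theorem empRademacher_eq_coe [Nonempty G] {n : ℕ} {x : Fin n → Input d}
    (h : empRademacher G x ≠ ⊤) :
    (∀ σ : Fin n → Label,
      BddAbove (Set.range fun g : G => (1 / (n : ℝ)) * ∑ i, ((σ i : ℤ) : ℝ) * g.1 (x i))) ∧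
      ((compRademacher G id x : ℝ) : EReal) ≤ empRademacher G x := by
  set E : (Fin n → Label) → EReal := fun σ =>
    ⨆ g ∈ G, (((1 / (n : ℝ)) * ∑ i, ((σ i : ℤ) : ℝ) * g (x i) : ℝ) : EReal) with hE
  have hle : ∀ σ (g : G), (((1 / (n : ℝ)) * ∑ i, ((σ i : ℤ) : ℝ) * g.1 (x i) : ℝ) : EReal) ≤ E σ :=
    fun σ g => le_iSup₂ (f := fun g (_ : g ∈ G) =>
      (((1 / (n : ℝ)) * ∑ i, ((σ i : ℤ) : ℝ) * g (x i) : ℝ) : EReal)) g.1 g.2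
  have hbot : ∀ σ, E σ ≠ ⊥ := fun σ hσ => by
    have := hle σ (Classical.arbitrary G)
    rw [hσ, le_bot_iff] at this
    exact EReal.coe_ne_bot _ this
  have hsum : ∑ σ, E σ ≠ ⊤ := fun hs => h (by
    rw [empRademacher, ← hE, hs]; exact EReal.coe_mul_top_of_pos (by positivity))
  have htop : ∀ σ, E σ ≠ ⊤ := fun σ =>
    EReal.ne_top_of_sum_ne_top _ hbot hsum (Finset.mem_univ σ)
  have hreal : ∀ σ, ((E σ).toReal : EReal) = E σ := fun σ => EReal.coe_toReal (htop σ) (hbot σ)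
  have hle' : ∀ σ (g : G), (1 / (n : ℝ)) * ∑ i, ((σ i : ℤ) : ℝ) * g.1 (x i) ≤ (E σ).toReal :=
    fun σ g => EReal.coe_le_coe_iff.1 ((hreal σ).symm ▸ hle σ g)
  refine ⟨fun σ => ⟨(E σ).toReal, by rintro _ ⟨g, rfl⟩; exact hle' σ g⟩, ?_⟩
  have : empRademacher G x = (((1 / 2 ^ n : ℝ) * ∑ σ, (E σ).toReal : ℝ) : EReal) := by
    rw [empRademacher, EReal.coe_mul, EReal.coe_finset_sum]
    simp only [hreal]
    rfl
  rw [this, EReal.coe_le_coe_iff, compRademacher]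
  gcongr with σ
  exact ciSup_le fun g => hle' σ g

/-- Two sign vectors that agree at `i` and are opposite elsewhere have signed sums adding up to `± 2
g (x i)`, so upper bounds for the signed averages bound each single value on both sides. -/
theorem absBdd_eval {n : ℕ} {x : Fin n → Input d}
    (h : ∀ σ : Fin n → Label,
      BddAbove (Set.range fun g : G => (1 / (n : ℝ)) * ∑ i, ((σ i : ℤ) : ℝ) * g.1 (x i)))
    (i : Fin n) : AbsBdd fun g : G => g.1 (x i) := by
  have hn : (0 : ℝ) < n := by exact_mod_cast i.pos
  choose M hM using h
  have key : ∀ (s : Label) (g : G), ((s : ℤ) : ℝ) * g.1 (x i) ≤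
      n * (M (Function.update 1 i s) + M (Function.update (-1) i s)) / 2 := by
    intro s g
    have h1 := hM (Function.update 1 i s) ⟨g, rfl⟩
    have h2 := hM (Function.update (-1) i s) ⟨g, rfl⟩
    have h3 : ∑ j, ((Function.update (1 : Fin n → Label) i s j : ℤ) : ℝ) * g.1 (x j) +
        ∑ j, ((Function.update (-1 : Fin n → Label) i s j : ℤ) : ℝ) * g.1 (x j) =
        2 * (((s : ℤ) : ℝ) * g.1 (x i)) := by
      rw [← Finset.sum_add_distrib, Finset.sum_eq_single i]
      · simp; ring
      · intro j _ hj; simp [Function.update_of_ne hj]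
      · simp
    simp only at h1 h2
    rw [one_div, inv_mul_le_iff₀ hn] at h1 h2
    linarith
  refine ⟨max (n * (M (Function.update 1 i 1) + M (Function.update (-1) i 1)) / 2)
    (n * (M (Function.update 1 i (-1)) + M (Function.update (-1) i (-1))) / 2), fun g => ?_⟩
  have h1 := key 1 g
  have h2 := key (-1) g
  simp only [Units.val_one, Int.cast_one, one_mul, Units.val_neg, Int.cast_neg, neg_mul] at h1 h2
  exact abs_le.2 ⟨by rw [neg_le]; exact le_max_of_le_right h2, le_max_of_le_left h1⟩

theorem compRademacher_le [Nonempty G] {h : ℝ → ℝ} (h0 : ∀ t, |h t| ≤ 1) {L : ℝ≥0} (hL : 0 < L)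
    (hLip : LipschitzWith L h) {n : ℕ} (x : Fin n → Input d) :
    ENNReal.ofReal (compRademacher G h x) ≤ L * (empRademacher G x).toENNReal := by
  by_cases htop : empRademacher G x = ⊤
  -- Here `0 < L` is essential: the right side is `⊤`, whereas `0 * ⊤ = 0`.
  · simp [htop, ENNReal.mul_top, hL.ne']
  obtain ⟨hb, hle⟩ := empRademacher_eq_coe htop
  have hev := absBdd_eval hb
  have hcontr := sum_iSup_contraction (ι := G) (fun i g => 1 / (n : ℝ) * h (g.1 (x i)))
    (fun i g => L * (1 / (n : ℝ)) * g.1 (x i)) (fun i => AbsBdd.const_mul ⟨1, fun g => h0 _⟩ _)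
    (fun i => (hev i).const_mul _) (fun i g g' => by
      rw [← mul_sub, ← mul_sub, abs_mul, abs_mul, abs_mul, mul_right_comm, mul_comm |1 / (n : ℝ)|,
        NNReal.abs_eq]
      gcongr
      have := hLip.dist_le_mul (g.1 (x i)) (g'.1 (x i))
      rwa [Real.dist_eq, Real.dist_eq] at this) 0 ⟨0, by simp⟩
  have hreal : compRademacher G h x ≤ L * compRademacher G id x := by
    rw [compRademacher, compRademacher, mul_left_comm, Finset.mul_sum (a := (L : ℝ))]
    refine mul_le_mul_of_nonneg_left ?_ (by positivity)
    refine (le_of_eq ?_).trans (hcontr.trans (le_of_eq ?_))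
    · refine Finset.sum_congr rfl fun σ _ => iSup_congr fun g => ?_
      rw [Finset.mul_sum, Pi.zero_apply, zero_add]
      exact Finset.sum_congr rfl fun i _ => by ring
    · refine Finset.sum_congr rfl fun σ _ => ?_
      rw [Real.mul_iSup_of_nonneg L.coe_nonneg]
      refine iSup_congr fun g => ?_
      rw [Finset.mul_sum, Finset.mul_sum, Pi.zero_apply, zero_add]
      exact Finset.sum_congr rfl fun i _ => by simp only [id]; ring
  calc ENNReal.ofReal (compRademacher G h x) ≤ ENNReal.ofReal (L * compRademacher G id x) :=
        ENNReal.ofReal_le_ofReal hreal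
    _ = L * ((compRademacher G id x : ℝ) : EReal).toENNReal := by
        rw [ENNReal.ofReal_mul L.coe_nonneg, ENNReal.ofReal_coe_nnreal, EReal.real_coe_toENNReal]
    _ ≤ _ := by gcongr; exact EReal.toENNReal_le_toENNReal hle

end Rademacher

/-! ### Symmetrization with a ghost sample -/

section Symmetrization

variable {G : Set (Input d → ℝ)} {h : ℝ → ℝ} {n : ℕ}

theorem abs_avg_le {n : ℕ} {f : Fin n → ℝ} {B : ℝ} (hB : 0 ≤ B) (hf : ∀ i, |f i| ≤ B) :
    |(1 / (n : ℝ)) * ∑ i, f i| ≤ B := by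
  rcases Nat.eq_zero_or_pos n with rfl | hn
  · simpa
  have hn' : (0 : ℝ) < n := by exact_mod_cast hn
  rw [abs_mul, abs_of_nonneg (by positivity), one_div, inv_mul_le_iff₀ hn']
  refine (Finset.abs_sum_le_sum_abs _ _).trans ((Finset.sum_le_sum fun i _ => hf i).trans ?_)
  simp

theorem abs_ciSup_le {ι : Type*} [Nonempty ι] {f : ι → ℝ} {B : ℝ} (hf : ∀ i, |f i| ≤ B) :
    |⨆ i, f i| ≤ B := by
  have hb : AbsBdd f := ⟨B, hf⟩
  refine abs_le.2 ⟨?_, ciSup_le fun i => (abs_le.1 (hf i)).2⟩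
  obtain ⟨i⟩ := ‹Nonempty ι›
  exact (abs_le.1 (hf i)).1.trans (le_ciSup hb.bddAbove i)

theorem abs_label_mul (s : Label) (t : ℝ) : |((s : ℤ) : ℝ) * t| = |t| := by
  rcases Int.units_eq_one_or s with rfl | rfl <;> simp

/-- `sup_g (1/n) ∑ᵢ σᵢ (h(g(x'ᵢ)) - h(g(xᵢ)))`. -/
def ghostSup (G : Set (Input d → ℝ)) (h : ℝ → ℝ) (σ : Fin n → Label)
    (z : (Fin n → Input d) × (Fin n → Input d)) : ℝ :=
  ⨆ g : G, (1 / (n : ℝ)) * ∑ i, ((σ i : ℤ) : ℝ) * (h (g.1 (z.2 i)) - h (g.1 (z.1 i)))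

theorem abs_sub_le_one (h0 : ∀ t, 0 ≤ h t) (h1 : ∀ t, h t ≤ 1) (s t : ℝ) : |h s - h t| ≤ 1 :=
  abs_le.2 ⟨by linarith [h0 s, h1 t], by linarith [h0 t, h1 s]⟩

theorem abs_ghostTerm_le (h0 : ∀ t, 0 ≤ h t) (h1 : ∀ t, h t ≤ 1) (σ : Fin n → Label)
    (a b : Fin n → ℝ) : |(1 / (n : ℝ)) * ∑ i, ((σ i : ℤ) : ℝ) * (h (a i) - h (b i))| ≤ 1 :=
  abs_avg_le zero_le_one fun i => by rw [abs_label_mul]; exact abs_sub_le_one h0 h1 _ _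

theorem abs_ghostSup_le [Nonempty G] (h0 : ∀ t, 0 ≤ h t) (h1 : ∀ t, h t ≤ 1) (σ : Fin n → Label)
    (z : (Fin n → Input d) × (Fin n → Input d)) : |ghostSup G h σ z| ≤ 1 :=
  abs_ciSup_le fun _ => abs_ghostTerm_le h0 h1 _ _ _

theorem measurable_ghostSup [Nonempty G] (hG : MeasurableClass G) (hc : Continuous h)
    (h0 : ∀ t, 0 ≤ h t) (h1 : ∀ t, h t ≤ 1) (σ : Fin n → Label) :
    Measurable (ghostSup G h σ) := by
  have := hG.measurable_iSup (κ := Fin n ⊕ Fin n) (B := 1)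
    (F := fun v => (1 / (n : ℝ)) * ∑ i, ((σ i : ℤ) : ℝ) * (h (v (.inr i)) - h (v (.inl i))))
    (by fun_prop) (fun v => abs_ghostTerm_le h0 h1 σ (fun i => v (.inr i)) (fun i => v (.inl i)))
  have hm : Measurable fun (z : (Fin n → Input d) × (Fin n → Input d)) =>
      (Sum.elim z.1 z.2 : Fin n ⊕ Fin n → Input d) := by
    refine measurable_pi_lambda _ fun i => ?_
    rcases i with i | i
    · exact (measurable_pi_apply i).comp measurable_fst
    · exact (measurable_pi_apply i).comp measurable_snd
  have h2 := this.comp hm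
  simp only [Function.comp_def, Sum.elim_inl, Sum.elim_inr] at h2
  exact h2

theorem abs_compTerm_le (h0 : ∀ t, 0 ≤ h t) (h1 : ∀ t, h t ≤ 1) (σ : Fin n → Label)
    (a : Fin n → ℝ) : |(1 / (n : ℝ)) * ∑ i, ((σ i : ℤ) : ℝ) * h (a i)| ≤ 1 :=
  abs_avg_le zero_le_one fun i => by
    rw [abs_label_mul]; exact abs_le.2 ⟨by linarith [h0 (a i)], h1 _⟩

theorem measurable_compRademacher [Nonempty G] (hG : MeasurableClass G) (hc : Continuous h)
    (h0 : ∀ t, 0 ≤ h t) (h1 : ∀ t, h t ≤ 1) :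
    Measurable fun x : Fin n → Input d => compRademacher G h x := by
  refine (Finset.measurable_sum _ fun σ _ => ?_).const_mul _
  exact hG.measurable_iSup (B := 1)
    (F := fun v : Fin n → ℝ => (1 / (n : ℝ)) * ∑ i, ((σ i : ℤ) : ℝ) * h (v i))
    (by fun_prop) (fun v => abs_compTerm_le h0 h1 σ v)

theorem abs_compRademacher_le [Nonempty G] (h0 : ∀ t, 0 ≤ h t) (h1 : ∀ t, h t ≤ 1)
    (x : Fin n → Input d) : |compRademacher G h x| ≤ 1 := by
  rw [compRademacher, abs_mul, abs_of_nonneg (by positivity), one_div, inv_mul_le_iff₀ (by positivity)]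
  refine (Finset.abs_sum_le_sum_abs _ _).trans ((Finset.sum_le_sum fun σ _ =>
    abs_ciSup_le fun g => abs_compTerm_le h0 h1 σ _).trans ?_)
  simp

/-- Exchanging `xᵢ` with `x'ᵢ` at the indices with `σᵢ = -1`. -/
def signSwap (σ : Fin n → Label) (z : (Fin n → Input d) × (Fin n → Input d)) :
    (Fin n → Input d) × (Fin n → Input d) :=
  (fun i => if σ i = 1 then z.1 i else z.2 i, fun i => if σ i = 1 then z.2 i else z.1 i)

/-- Regrouped into pairs `(xᵢ, x'ᵢ)`, the law is a product of copies of `q.prod q`, each invariant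
under exchange. -/
theorem measurePreserving_signSwap (q : Measure (Input d)) [IsProbabilityMeasure q]
    (σ : Fin n → Label) :
    MeasurePreserving (signSwap σ) ((sampleLaw q n).prod (sampleLaw q n))
      ((sampleLaw q n).prod (sampleLaw q n)) := by
  have he := measurePreserving_arrowProdEquivProdArrow (Input d) (Input d) (Fin n)
    (fun _ => q) (fun _ => q)
  have hp := measurePreserving_pi (fun _ : Fin n => q.prod q) (fun _ : Fin n => q.prod q)
    (f := fun i z => if σ i = 1 then z else z.swap) fun i => by
      by_cases hi : σ i = 1
      · simp only [hi, if_true]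
        exact MeasurePreserving.id _
      · simp only [hi, if_false]
        exact Measure.measurePreserving_swap
  unfold sampleLaw
  convert (he.comp hp).comp he.symm using 1
  funext z
  refine Prod.ext (funext fun i => ?_) (funext fun i => ?_) <;>
  · by_cases hi : σ i = 1 <;>
    simp [signSwap, hi, MeasurableEquiv.arrowProdEquivProdArrow, Equiv.arrowProdEquivProdArrow]

theorem ghostSup_signSwap (σ : Fin n → Label) (z : (Fin n → Input d) × (Fin n → Input d)) :
    ghostSup G h 1 (signSwap σ z) = ghostSup G h σ z := by
  refine iSup_congr fun g => ?_
  congr 1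
  refine Finset.sum_congr rfl fun i _ => ?_
  rcases Int.units_eq_one_or (σ i) with hi | hi <;> simp [signSwap, hi]

/-- The supremum of a difference splits into two suprema; the minus sign is absorbed by reindexing
with `σ ↦ -σ`. -/
theorem sum_ghostSup_le [Nonempty G] (h0 : ∀ t, 0 ≤ h t) (h1 : ∀ t, h t ≤ 1)
    (z : (Fin n → Input d) × (Fin n → Input d)) :
    (1 / 2 ^ n : ℝ) * ∑ σ, ghostSup G h σ z ≤ compRademacher G h z.1 + compRademacher G h z.2 := by
  have hneg : compRademacher G h z.1 = (1 / 2 ^ n : ℝ) * ∑ σ : Fin n → Label, ⨆ g : G,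
      (1 / (n : ℝ)) * ∑ i, (((-σ) i : Label) : ℤ) * h (g.1 (z.1 i)) := by
    rw [compRademacher]
    congr 1
    exact Fintype.sum_equiv (Equiv.neg _) _ _ fun σ => by simp
  rw [hneg, compRademacher, ← mul_add, ← Finset.sum_add_distrib]
  gcongr with σ
  refine ciSup_le fun g => ?_
  have e1 := le_ciSup (AbsBdd.bddAbove ⟨1, fun g : G =>
    abs_compTerm_le h0 h1 (-σ) fun i => g.1 (z.1 i)⟩) g
  have e2 := le_ciSup (AbsBdd.bddAbove ⟨1, fun g : G =>
    abs_compTerm_le h0 h1 σ fun i => g.1 (z.2 i)⟩) g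
  refine le_trans (le_of_eq ?_) (add_le_add e1 e2)
  rw [← mul_add, ← Finset.sum_add_distrib]
  congr 1
  refine Finset.sum_congr rfl fun i _ => ?_
  simp only [Pi.neg_apply, Units.val_neg, Int.cast_neg]
  ring

instance (q : Measure (Input d)) [IsProbabilityMeasure q] : IsProbabilityMeasure (sampleLaw q n) := by
  unfold sampleLaw; infer_instance

/-- By exchangeability the expectation is the same for every sign vector, so it equals its average
over `σ`, which splits into two Rademacher averages. -/
theorem integral_ghostSup_le [Nonempty G] (hG : MeasurableClass G) (hc : Continuous h)
    (h0 : ∀ t, 0 ≤ h t) (h1 : ∀ t, h t ≤ 1) (q : Measure (Input d)) [IsProbabilityMeasure q] :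
    ∫ z, ghostSup G h (1 : Fin n → Label) z ∂((sampleLaw q n).prod (sampleLaw q n)) ≤
      2 * ∫ x, compRademacher G h x ∂(sampleLaw q n) := by
  set μ := sampleLaw q n
  have hm := fun σ => measurable_ghostSup (n := n) hG hc h0 h1 σ
  have hi : ∀ σ, Integrable (ghostSup G h σ) (μ.prod μ) := fun σ =>
    integrable_of_abs_le (hm σ) (abs_ghostSup_le h0 h1 σ)
  have hR : Integrable (fun x => compRademacher G h x) μ :=
    integrable_of_abs_le (measurable_compRademacher hG hc h0 h1) (abs_compRademacher_le h0 h1)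
  have heq : ∀ σ : Fin n → Label, ∫ z, ghostSup G h σ z ∂(μ.prod μ) =
      ∫ z, ghostSup G h 1 z ∂(μ.prod μ) := fun σ => by
    have hp := measurePreserving_signSwap (n := n) q σ
    conv_rhs => rw [← hp.map_eq]
    rw [integral_map hp.measurable.aemeasurable (hm 1).aestronglyMeasurable]
    simp only [ghostSup_signSwap]
    rfl
  have hcard : (Fintype.card (Fin n → Label) : ℝ) = 2 ^ n := by
    simp
  calc ∫ z, ghostSup G h 1 z ∂(μ.prod μ)
      = (1 / 2 ^ n : ℝ) * ∑ σ : Fin n → Label, ∫ z, ghostSup G h σ z ∂(μ.prod μ) := by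
        simp only [heq, Finset.sum_const, Finset.card_univ, nsmul_eq_mul, hcard]
        field_simp
    _ = ∫ z, (1 / 2 ^ n : ℝ) * ∑ σ, ghostSup G h σ z ∂(μ.prod μ) := by
        rw [integral_const_mul, integral_finsetSum _ fun σ _ => hi σ]
    _ ≤ ∫ z, (compRademacher G h z.1 + compRademacher G h z.2) ∂(μ.prod μ) := by
        refine integral_mono ((integrable_finsetSum _ fun σ _ => hi σ).const_mul _)
          ((hR.comp_fst μ).add (hR.comp_snd μ)) (sum_ghostSup_le h0 h1)
    _ = _ := by
        rw [integral_add (hR.comp_fst μ) (hR.comp_snd μ), integral_fun_fst, integral_fun_snd]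
        simp [two_mul]

theorem integral_compRademacher_le [Nonempty G] (hG : MeasurableClass G)
    (h0 : ∀ t, 0 ≤ h t) (h1 : ∀ t, h t ≤ 1) {L : ℝ≥0} (hLip : LipschitzWith L h)
    (q : Measure (Input d)) [IsProbabilityMeasure q] {C : ℝ} (hC : 0 ≤ C)
    (hq : rademacher n q G ≤ ENNReal.ofReal C) :
    ∫ x, compRademacher G h x ∂(sampleLaw q n) ≤ L * C := by
  have hR : Integrable (fun x => compRademacher G h x) (sampleLaw q n) :=
    integrable_of_abs_le (measurable_compRademacher hG hLip.continuous h0 h1)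
      (abs_compRademacher_le h0 h1)
  have habs : ∀ t, |h t| ≤ 1 := fun t => abs_le.2 ⟨by linarith [h0 t], h1 t⟩
  -- Working with `L' > L` and letting `L'` decrease to `L` covers `L = 0`, which
  -- `compRademacher_le` excludes.
  have key : ∀ L' : ℝ≥0, L < L' → ∫ x, compRademacher G h x ∂(sampleLaw q n) ≤ L' * C := by
    intro L' hL'
    have hpos : 0 < L' := lt_of_le_of_lt zero_le hL'
    refine (ENNReal.ofReal_le_ofReal_iff (by positivity)).1 ?_
    calc ENNReal.ofReal (∫ x, compRademacher G h x ∂(sampleLaw q n))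
        ≤ ENNReal.ofReal (∫ x, max (compRademacher G h x) 0 ∂(sampleLaw q n)) := by
          refine ENNReal.ofReal_le_ofReal (integral_mono hR hR.pos_part fun x => le_max_left _ _)
      _ = ∫⁻ x, ENNReal.ofReal (compRademacher G h x) ∂(sampleLaw q n) := by
          rw [ofReal_integral_eq_lintegral_ofReal hR.pos_part (.of_forall fun x => le_max_right _ _)]
          simp
      _ ≤ ∫⁻ x, L' * (empRademacher G x).toENNReal ∂(sampleLaw q n) :=
          lintegral_mono fun x => compRademacher_le habs hpos (hLip.weaken hL'.le) x
      _ = L' * rademacher n q G := lintegral_const_mul' _ _ ENNReal.coe_ne_top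
      _ ≤ L' * ENNReal.ofReal C := by gcongr
      _ = ENNReal.ofReal (L' * C) := by
          rw [ENNReal.ofReal_mul L'.coe_nonneg, ENNReal.ofReal_coe_nnreal]
  refine le_of_forall_pos_le_add fun ε hε => ?_
  -- The increment times `C` is at most `ε`; the `+ 1` keeps the denominator positive when `C = 0`.
  have h2 := key (L + (ε / (C + 1)).toNNReal)
    (lt_add_of_pos_right _ (Real.toNNReal_pos.2 (by positivity)))
  refine h2.trans ?_
  rw [NNReal.coe_add, add_mul, Real.coe_toNNReal _ (by positivity)]
  gcongr
  rw [div_mul_eq_mul_div, div_le_iff₀ (by positivity)]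
  nlinarith

end Symmetrization

/-! ### Uniform deviation for a single sample -/

section Concentration

variable {G : Set (Input d → ℝ)} {h : ℝ → ℝ} {n : ℕ}

/-- The empirical average `(1/n) ∑ᵢ h(g(xᵢ))`. -/
def compAvg (h : ℝ → ℝ) (g : Input d → ℝ) (x : Fin n → Input d) : ℝ :=
  (1 / (n : ℝ)) * ∑ i, h (g (x i))

theorem abs_compAvg_le (h0 : ∀ t, 0 ≤ h t) (h1 : ∀ t, h t ≤ 1) (g : Input d → ℝ)
    (x : Fin n → Input d) : |compAvg h g x| ≤ 1 :=
  abs_avg_le zero_le_one fun i => abs_le.2 ⟨by linarith [h0 (g (x i))], h1 _⟩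

theorem measurable_compAvg (hc : Continuous h) {g : Input d → ℝ} (hg : Measurable g) :
    Measurable fun x : Fin n → Input d => compAvg h g x := by
  unfold compAvg
  have := hc.measurable
  fun_prop

theorem integral_compAvg (hn : 0 < n) (hc : Continuous h) (h0 : ∀ t, 0 ≤ h t) (h1 : ∀ t, h t ≤ 1)
    {g : Input d → ℝ} (hg : Measurable g) (q : Measure (Input d)) [IsProbabilityMeasure q] :
    ∫ x, compAvg h g x ∂(sampleLaw q n) = ∫ x, h (g x) ∂q := by
  have hm : Measurable fun x => h (g x) := hc.measurable.comp hg
  have hi : ∀ i, Integrable (fun x : Fin n → Input d => h (g (x i))) (sampleLaw q n) := fun i =>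
    integrable_of_abs_le (B := 1) (hm.comp (measurable_pi_apply i)) fun x =>
      abs_le.2 ⟨by linarith [h0 (g (x i))], h1 _⟩
  have he : ∀ i, ∫ x : Fin n → Input d, h (g (x i)) ∂(sampleLaw q n) = ∫ x, h (g x) ∂q := fun i => by
    have hp := measurePreserving_eval (fun _ : Fin n => q) i
    conv_rhs => rw [← hp.map_eq]
    rw [integral_map hp.measurable.aemeasurable hm.aestronglyMeasurable]
    rfl
  have hn' : (n : ℝ) ≠ 0 := by exact_mod_cast hn.ne'
  unfold compAvg
  rw [integral_const_mul, integral_finsetSum _ fun i _ => hi i]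
  simp [he, hn']

theorem compAvg_update_sub_le (hn : 0 < n) (h0 : ∀ t, 0 ≤ h t) (h1 : ∀ t, h t ≤ 1)
    (g : Input d → ℝ) (x : Fin n → Input d) (i : Fin n) (v : Input d) :
    |compAvg h g (Function.update x i v) - compAvg h g x| ≤ 1 / n := by
  have hn' : (0 : ℝ) < n := by exact_mod_cast hn
  have : compAvg h g (Function.update x i v) - compAvg h g x =
      1 / (n : ℝ) * (h (g v) - h (g (x i))) := by
    rw [compAvg, compAvg, ← mul_sub, ← Finset.sum_sub_distrib, Finset.sum_eq_single i]
    · simp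
    · intro j _ hj; simp [Function.update_of_ne hj]
    · simp
  rw [this, abs_mul, abs_of_pos (by positivity)]
  exact mul_le_of_le_one_right (by positivity) (abs_sub_le_one h0 h1 _ _)

theorem ghostSup_one_eq (x x' : Fin n → Input d) :
    ghostSup G h 1 (x, x') = ⨆ g : G, (compAvg h g.1 x' - compAvg h g.1 x) := by
  refine iSup_congr fun g => ?_
  simp [compAvg, ← mul_sub, Finset.sum_sub_distrib]

/-- A measurable majorant of the uniform deviation of `g ↦ h ∘ g` relative to the reference
function `g₀`; the population means are replaced by those of an independent ghost sample. -/
def deviation (G : Set (Input d → ℝ)) (h : ℝ → ℝ) (q : Measure (Input d)) (g₀ : Input d → ℝ)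
    (x : Fin n → Input d) : ℝ :=
  ∫ x', ghostSup G h 1 (x, x') ∂(sampleLaw q n) + (compAvg h g₀ x - ∫ y, h (g₀ y) ∂q)

variable [Nonempty G] (hG : MeasurableClass G) (hc : Continuous h)
  (h0 : ∀ t, 0 ≤ h t) (h1 : ∀ t, h t ≤ 1) (q : Measure (Input d)) [IsProbabilityMeasure q]
include hG hc h0 h1

theorem integrable_ghostSup_right (x : Fin n → Input d) :
    Integrable (fun x' => ghostSup G h 1 (x, x')) (sampleLaw q n) :=
  integrable_of_abs_le ((measurable_ghostSup hG hc h0 h1 1).comp measurable_prodMk_left)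
    fun _ => abs_ghostSup_le h0 h1 _ _

theorem measurable_deviation {g₀ : Input d → ℝ} (hg₀ : g₀ ∈ G) :
    Measurable fun x : Fin n → Input d => deviation G h q g₀ x := by
  refine Measurable.add ?_ ((measurable_compAvg hc (hG.measurable_mem _ hg₀)).sub_const _)
  exact (StronglyMeasurable.integral_prod_right'
    (measurable_ghostSup hG hc h0 h1 1).stronglyMeasurable).measurable

/-- The population mean of `h ∘ g` is the expected ghost average, and an expectation of differences
is at most the expectation of their supremum. -/
theorem le_deviation (hn : 0 < n) {g₀ g : Input d → ℝ} (hg : g ∈ G)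
    (x : Fin n → Input d) :
    ∫ y, h (g y) ∂q - compAvg h g x + (compAvg h g₀ x - ∫ y, h (g₀ y) ∂q) ≤
      deviation G h q g₀ x := by
  refine add_le_add ?_ le_rfl
  have hgm := hG.measurable_mem g hg
  have hi : Integrable (fun x' : Fin n → Input d => compAvg h g x') (sampleLaw q n) :=
    integrable_of_abs_le (measurable_compAvg hc hgm) (abs_compAvg_le h0 h1 g)
  calc _ = ∫ x', (compAvg h g x' - compAvg h g x) ∂(sampleLaw q n) := by
        rw [integral_sub hi (integrable_const _), integral_compAvg hn hc h0 h1 hgm]; simp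
    _ ≤ _ := by
        refine integral_mono (hi.sub (integrable_const _))
          (integrable_ghostSup_right hG hc h0 h1 q x) fun x' => ?_
        simp only [ghostSup_one_eq]
        refine le_ciSup (f := fun g : G => compAvg h g.1 x' - compAvg h g.1 x)
          (AbsBdd.bddAbove ⟨2, fun g => ?_⟩) ⟨g, hg⟩
        have e1 := abs_le.1 (abs_compAvg_le h0 h1 g.1 x')
        have e2 := abs_le.1 (abs_compAvg_le h0 h1 g.1 x)
        exact abs_le.2 ⟨by linarith, by linarith⟩

omit [Nonempty G] hG hc in
theorem abs_integral_comp_le {g : Input d → ℝ} : |∫ y, h (g y) ∂q| ≤ 1 := by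
  refine (norm_integral_le_of_norm_le_const (f := fun y => h (g y)) (C := 1)
    (.of_forall fun y => abs_le.2 ⟨by linarith [h0 (g y)], h1 _⟩)).trans ?_
  simp

omit hG hc in
theorem abs_integral_ghostSup_le (x : Fin n → Input d) :
    |∫ x', ghostSup G h 1 (x, x') ∂(sampleLaw q n)| ≤ 1 := by
  refine (norm_integral_le_of_norm_le_const (f := fun x' => ghostSup G h 1 (x, x')) (C := 1)
    (.of_forall fun y => abs_ghostSup_le h0 h1 _ _)).trans ?_
  simp

omit hG hc in
theorem abs_deviation_le (g₀ : Input d → ℝ) (x : Fin n → Input d) :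
    |deviation G h q g₀ x| ≤ 3 := by
  have e1 := abs_le.1 (abs_integral_ghostSup_le (G := G) h0 h1 q x)
  have e2 := abs_le.1 (abs_integral_comp_le h0 h1 q (g := g₀))
  have e3 := abs_le.1 (abs_compAvg_le h0 h1 g₀ x)
  exact abs_le.2 ⟨by unfold deviation; linarith, by unfold deviation; linarith⟩

/-- An empirical average moves by at most `1 / n`; the sample enters once inside the supremum and
once through `g₀`. -/
theorem deviation_update_sub_le (hn : 0 < n) (g₀ : Input d → ℝ)
    (x : Fin n → Input d) (i : Fin n) (v : Input d) :
    deviation G h q g₀ (Function.update x i v) - deviation G h q g₀ x ≤ 2 / n := by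
  have e1 : ∫ x', ghostSup G h 1 (Function.update x i v, x') ∂(sampleLaw q n) -
      ∫ x', ghostSup G h 1 (x, x') ∂(sampleLaw q n) ≤ 1 / n := by
    rw [← integral_sub (integrable_ghostSup_right hG hc h0 h1 q _)
      (integrable_ghostSup_right hG hc h0 h1 q _)]
    calc _ ≤ ∫ _, (1 / n : ℝ) ∂(sampleLaw q n) := by
          refine integral_mono ((integrable_ghostSup_right hG hc h0 h1 q _).sub
            (integrable_ghostSup_right hG hc h0 h1 q _)) (integrable_const _) fun x' => ?_
          rw [sub_le_iff_le_add]
          simp only [ghostSup_one_eq]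
          refine ciSup_le fun g => ?_
          have hb : AbsBdd fun g : G => compAvg h g.1 x' - compAvg h g.1 x := ⟨2, fun g => by
            have e1 := abs_le.1 (abs_compAvg_le h0 h1 g.1 x')
            have e2 := abs_le.1 (abs_compAvg_le h0 h1 g.1 x)
            exact abs_le.2 ⟨by linarith, by linarith⟩⟩
          have e2 := le_ciSup hb.bddAbove g
          have e3 := abs_le.1 (compAvg_update_sub_le hn h0 h1 g.1 x i v)
          linarith
      _ = _ := by simp
  have e2 := (abs_le.1 (compAvg_update_sub_le hn h0 h1 g₀ x i v)).2
  have e3 : (2 : ℝ) / n = 1 / n + 1 / n := by ring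
  unfold deviation
  linarith

/-- The term in `g₀` is centered, so including the reference function costs nothing in the mean. -/
theorem integral_deviation (hn : 0 < n) {g₀ : Input d → ℝ} (hg₀ : g₀ ∈ G) :
    ∫ x, deviation G h q g₀ x ∂(sampleLaw q n) =
      ∫ z, ghostSup G h (1 : Fin n → Label) z ∂((sampleLaw q n).prod (sampleLaw q n)) := by
  have hgm := hG.measurable_mem g₀ hg₀
  have hi : Integrable (fun x' : Fin n → Input d => compAvg h g₀ x') (sampleLaw q n) :=
    integrable_of_abs_le (measurable_compAvg hc hgm) (abs_compAvg_le h0 h1 g₀)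
  have hI : Integrable (fun x : Fin n → Input d =>
      ∫ x', ghostSup G h 1 (x, x') ∂(sampleLaw q n)) (sampleLaw q n) :=
    integrable_of_abs_le (StronglyMeasurable.integral_prod_right'
      (measurable_ghostSup hG hc h0 h1 1).stronglyMeasurable).measurable
      (abs_integral_ghostSup_le h0 h1 q)
  have hprod := integral_prod (μ := sampleLaw q n) (ν := sampleLaw q n) (ghostSup G h 1)
    (integrable_of_abs_le (measurable_ghostSup hG hc h0 h1 1) (abs_ghostSup_le h0 h1 1))
  have hs : Integrable (fun x : Fin n → Input d => compAvg h g₀ x - ∫ y, h (g₀ y) ∂q)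
      (sampleLaw q n) := hi.sub (integrable_const _)
  unfold deviation
  rw [integral_add hI hs, integral_sub hi (integrable_const _),
    integral_compAvg hn hc h0 h1 hgm, hprod]
  simp

/-- Uniform deviation bound for one sample. -/
theorem exists_event_uniform_deviation (hn : 0 < n) {L : ℝ≥0} (hLip : LipschitzWith L h)
    {C : ℝ} (hC : 0 ≤ C) (hq : rademacher n q G ≤ ENNReal.ofReal (C / √n))
    {g₀ : Input d → ℝ} (hg₀ : g₀ ∈ G) {δ : ℝ} (hδ0 : 0 < δ) (hδ1 : δ < 1) :
    ∃ E : Set (Fin n → Input d), MeasurableSet E ∧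
      ENNReal.ofReal (1 - δ / 4) ≤ sampleLaw q n E ∧
      ∀ x ∈ E, ∀ g ∈ G,
        ∫ y, h (g y) ∂q - compAvg h g x + (compAvg h g₀ x - ∫ y, h (g₀ y) ∂q) ≤
          fDelta L C δ / √n := by
  have hn' : (0 : ℝ) < n := by exact_mod_cast hn
  set m := ∫ x, deviation G h q g₀ x ∂(sampleLaw q n) with hm
  -- Chosen so that `exp (-n ε² / 2) = δ / 4`, the tail for variance proxy `n * (2 / n / 2) ^ 2 = 1
  -- / n`.
  set ε := √(2 * Real.log (4 / δ)) / √n with hε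
  have hlog : 0 ≤ 2 * Real.log (4 / δ) :=
    mul_nonneg zero_le_two (Real.log_nonneg (by rw [le_div_iff₀ hδ0]; linarith))
  have hmle : m ≤ 2 * (L * (C / √n)) := by
    rw [hm, integral_deviation hG hc h0 h1 q hn hg₀]
    exact (integral_ghostSup_le hG hc h0 h1 q).trans (mul_le_mul_of_nonneg_left
      (integral_compRademacher_le hG h0 h1 hLip q (by positivity) hq) zero_le_two)
  have hmeas := measurable_deviation (n := n) hG hc h0 h1 q hg₀
  have hbad : MeasurableSet {x : Fin n → Input d | ε ≤ deviation G h q g₀ x - m} :=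
    measurableSet_le measurable_const (hmeas.sub_const _)
  refine ⟨{x | ε ≤ deviation G h q g₀ x - m}ᶜ, hbad.compl, ?_, fun x hx g hg => ?_⟩
  · have hsub := hasSubgaussianMGF_of_boundedDiff q (2 / n) n (fun x => deviation G h q g₀ x) hmeas
      (abs_deviation_le h0 h1 q g₀) (fun x i v => by
        simpa using deviation_update_sub_le hG hc h0 h1 q hn g₀ x i v)
    have htail := hsub.measure_ge_le (ε := ε) (by positivity)
    have hexp : Real.exp (-ε ^ 2 / (2 * ((n * (2 / n / 2) ^ 2 : ℝ≥0) : ℝ))) = δ / 4 := by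
      rw [hε, div_pow, Real.sq_sqrt hlog, Real.sq_sqrt hn'.le]
      have : -(2 * Real.log (4 / δ) / n) / (2 * ((n * (2 / n / 2) ^ 2 : ℝ≥0) : ℝ)) =
          Real.log (δ / 4) := by
        rw [show δ / 4 = (4 / δ)⁻¹ by rw [inv_div], Real.log_inv]
        push_cast
        field_simp
      rw [this, Real.exp_log (by positivity)]
    rw [hexp] at htail
    have : 1 - δ / 4 ≤ (sampleLaw q n).real {x | ε ≤ deviation G h q g₀ x - m}ᶜ := by
      rw [probReal_compl_eq_one_sub hbad]
      exact sub_le_sub_left htail _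
    exact (ENNReal.ofReal_le_ofReal this).trans (by rw [ofReal_measureReal])
  · have h2 := le_deviation hG hc h0 h1 q hn (g₀ := g₀) hg x
    have h3 : deviation G h q g₀ x - m < ε := not_le.1 hx
    have h4 : fDelta L C δ / √n = 4 * (L * (C / √n)) + ε := by
      rw [fDelta, hε]; ring
    -- The mean uses only `2 L C / √n` of the available `4 L C / √n`.
    have h5 : 0 ≤ L * (C / √n) := by positivity
    linarith

end Concentration

/-! ### Excess risk from two independent samples -/

section TwoSample

variable {G : Set (Input d → ℝ)}

theorem HoldsWithProb.of_nonpos {Ω : Type*} [MeasurableSpace Ω] {μ : Measure Ω} {r : ℝ}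
    (hr : r ≤ 0) (A : Set Ω) : HoldsWithProb μ r A :=
  ⟨∅, Set.empty_subset _, .empty, by simp [ENNReal.ofReal_of_nonpos hr]⟩

/-- The estimation error bound for an empirical risk that combines two independent samples. -/
theorem holdsWithProb_two_sample (hG : MeasurableClass G) {ℓ : ℝ → Label → ℝ}
    (h0 : ∀ t y, 0 ≤ ℓ t y) (h1 : ∀ t y, ℓ t y ≤ 1) {L : ℝ≥0}
    (hLip : ∀ y, LipschitzWith L fun t => ℓ t y) {C : ℝ} (hC : 0 ≤ C)
    {q₁ q₂ : Measure (Input d)} [IsProbabilityMeasure q₁] [IsProbabilityMeasure q₂]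
    {n₁ n₂ : ℕ} (hn₁ : 0 < n₁) (hn₂ : 0 < n₂)
    (hq₁ : rademacher n₁ q₁ G ≤ ENNReal.ofReal (C / √n₁))
    (hq₂ : rademacher n₂ q₂ G ≤ ENNReal.ofReal (C / √n₂))
    (y₁ y₂ : Label) {a b c : ℝ} (ha : 0 ≤ a) (hb : 0 ≤ b) {R : (Input d → ℝ) → ℝ}
    (hR : ∀ g ∈ G, R g = c + a * ∫ x, ℓ (g x) y₁ ∂q₁ + b * ∫ x, ℓ (g x) y₂ ∂q₂)
    {Re : (Fin n₁ → Input d) → (Fin n₂ → Input d) → (Input d → ℝ) → ℝ}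
    (hRe : ∀ x₁ x₂ g, Re x₁ x₂ g = c + a * empAvg ℓ y₁ x₁ g + b * empAvg ℓ y₂ x₂ g)
    {g₀ : Input d → ℝ} (hg₀ : g₀ ∈ G) {δ : ℝ} (hδ : 0 < δ) :
    HoldsWithProb ((sampleLaw q₁ n₁).prod (sampleLaw q₂ n₂)) (1 - δ)
      {s | ∀ ghat, IsArgmin (Re s.1 s.2) G ghat →
        R ghat - R g₀ ≤ fDelta L C δ * (a / √n₁ + b / √n₂)} := by
  -- For `δ ≥ 1` the empty event suffices; otherwise the logarithm in `fDelta` is positive.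
  rcases le_or_gt 1 δ with hδ1 | hδ1
  · exact .of_nonpos (by linarith) _
  have : Nonempty G := ⟨⟨g₀, hg₀⟩⟩
  obtain ⟨E₁, hE₁, hp₁, hb₁⟩ := exists_event_uniform_deviation hG (hLip y₁).continuous
    (fun t => h0 t y₁) (fun t => h1 t y₁) q₁ hn₁ (hLip y₁) hC hq₁ hg₀ hδ hδ1
  obtain ⟨E₂, hE₂, hp₂, hb₂⟩ := exists_event_uniform_deviation hG (hLip y₂).continuous
    (fun t => h0 t y₂) (fun t => h1 t y₂) q₂ hn₂ (hLip y₂) hC hq₂ hg₀ hδ hδ1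
  refine ⟨E₁ ×ˢ E₂, ?_, hE₁.prod hE₂, ?_⟩
  · rintro ⟨x₁, x₂⟩ ⟨hx₁, hx₂⟩ g ⟨hg, hmin⟩
    have e1 := mul_le_mul_of_nonneg_left (hb₁ x₁ hx₁ g hg) ha
    have e2 := mul_le_mul_of_nonneg_left (hb₂ x₂ hx₂ g hg) hb
    have e3 := hmin g₀ hg₀
    rw [hRe, hRe] at e3
    change c + a * compAvg (ℓ · y₁) g x₁ + b * compAvg (ℓ · y₂) g x₂ ≤
      c + a * compAvg (ℓ · y₁) g₀ x₁ + b * compAvg (ℓ · y₂) g₀ x₂ at e3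
    rw [hR g hg, hR g₀ hg₀]
    have e4 : fDelta L C δ * (a / √n₁ + b / √n₂) =
        a * (fDelta L C δ / √n₁) + b * (fDelta L C δ / √n₂) := by ring
    rw [e4]
    linarith
  · rw [Measure.prod_prod]
    refine le_trans ?_ (mul_le_mul' hp₁ hp₂)
    rw [← ENNReal.ofReal_mul (by linarith)]
    -- `(1 - δ/4)² ≥ 1 - δ/2 ≥ 1 - δ`.
    exact ENNReal.ofReal_le_ofReal (by nlinarith)

end TwoSample

/-! ### Unbiasedness of the PN, PU and NU risks -/

section Risk

open ProbabilityTheory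

variable {P : Measure (Input d × Label)} [IsProbabilityMeasure P]

theorem measurableSet_label (y : Label) : MeasurableSet {z : Input d × Label | z.2 = y} :=
  measurable_snd (measurableSet_singleton y)

theorem compl_label_one : {z : Input d × Label | z.2 = 1}ᶜ = {z | z.2 = -1} := by
  ext z
  rcases Int.units_eq_one_or z.2 with h | h <;> simp [h]

theorem measureReal_label_neg_one : P.real {z | z.2 = -1} = 1 - classPrior P := by
  rw [← compl_label_one, probReal_compl_eq_one_sub (measurableSet_label 1)]
  rfl

theorem isProbabilityMeasure_condMarginal {y : Label} (hy : 0 < P.real {z | z.2 = y}) :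
    IsProbabilityMeasure (condMarginal P y) := by
  have : IsProbabilityMeasure (ProbabilityTheory.cond P {z | z.2 = y}) :=
    cond_isProbabilityMeasure (fun h => by simp [Measure.real, h] at hy)
  exact Measure.isProbabilityMeasure_map measurable_fst.aemeasurable

instance : IsProbabilityMeasure (marginal P) :=
  Measure.isProbabilityMeasure_map measurable_fst.aemeasurable

omit [IsProbabilityMeasure P] in
theorem setIntegral_label {y : Label} (hy : 0 < P.real {z | z.2 = y}) (f : Input d × Label → ℝ)
    (hf : Measurable fun x => f (x, y)) :
    ∫ z in {z | z.2 = y}, f z ∂P =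
      P.real {z | z.2 = y} * ∫ x, f (x, y) ∂(condMarginal P y) := by
  have h1 : ∫ z in {z | z.2 = y}, f z ∂P = ∫ z in {z | z.2 = y}, f (z.1, y) ∂P :=
    setIntegral_congr_fun (measurableSet_label y) fun z hz => by
      rw [← show z.2 = y from hz]
  rw [condMarginal, integral_map measurable_fst.aemeasurable hf.aestronglyMeasurable,
    ProbabilityTheory.cond, integral_smul_measure, h1, ENNReal.toReal_inv, smul_eq_mul,
    ← mul_assoc]
  change _ = P.real {z | z.2 = y} * (P.real {z | z.2 = y})⁻¹ * _
  rw [mul_inv_cancel₀ hy.ne', one_mul]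

theorem integral_eq_class_mixture (h0 : 0 < classPrior P) (h1 : classPrior P < 1)
    (f : Input d × Label → ℝ) (hf : ∀ y, Measurable fun x => f (x, y)) (hi : Integrable f P) :
    ∫ z, f z ∂P = classPrior P * ∫ x, f (x, 1) ∂(condMarginal P 1) +
      (1 - classPrior P) * ∫ x, f (x, -1) ∂(condMarginal P (-1)) := by
  rw [← integral_add_compl (measurableSet_label 1) hi, compl_label_one, setIntegral_label h0 f (hf 1),
    setIntegral_label (by rw [measureReal_label_neg_one]; linarith) f (hf (-1)),
    measureReal_label_neg_one]
  rfl

variable {ℓ : ℝ → Label → ℝ} (hprior0 : 0 < classPrior P) (hprior1 : classPrior P < 1)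
  (h0 : ∀ t y, 0 ≤ ℓ t y) (h1 : ∀ t y, ℓ t y ≤ 1) (hc : ∀ y, Continuous fun t => ℓ t y)
include hprior0 hprior1 h0 h1 hc

theorem risk_eq_pn {g : Input d → ℝ} (hg : Measurable g) :
    risk P ℓ g = classPrior P * ∫ x, ℓ (g x) 1 ∂(condMarginal P 1) +
      (1 - classPrior P) * ∫ x, ℓ (g x) (-1) ∂(condMarginal P (-1)) := by
  have hm : ∀ y, Measurable fun x => ℓ (g x) y := fun y => (hc y).measurable.comp hg
  refine integral_eq_class_mixture hprior0 hprior1 (fun z => ℓ (g z.1) z.2) hm ?_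
  refine integrable_of_abs_le (B := 1) ?_ fun z =>
    abs_le.2 ⟨by linarith [h0 (g z.1) z.2], h1 _ _⟩
  exact measurable_from_prod_countable_left hm

theorem integral_marginal_eq (y : Label) {g : Input d → ℝ} (hg : Measurable g) :
    ∫ x, ℓ (g x) y ∂(marginal P) = classPrior P * ∫ x, ℓ (g x) y ∂(condMarginal P 1) +
      (1 - classPrior P) * ∫ x, ℓ (g x) y ∂(condMarginal P (-1)) := by
  have hm : Measurable fun x => ℓ (g x) y := (hc y).measurable.comp hg
  rw [marginal, integral_map measurable_fst.aemeasurable hm.aestronglyMeasurable]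
  refine integral_eq_class_mixture hprior0 hprior1 (fun z => ℓ (g z.1) y) (fun _ => hm) ?_
  exact integrable_of_abs_le (B := 1) (hm.comp measurable_fst) fun z =>
    abs_le.2 ⟨by linarith [h0 (g z.1) y], h1 _ _⟩

omit hprior0 hprior1 in
theorem integral_loss_neg_one (hsymm : ∀ t, ℓ t 1 + ℓ t (-1) = 1) (q : Measure (Input d))
    [IsProbabilityMeasure q] {g : Input d → ℝ} (hg : Measurable g) :
    ∫ x, ℓ (g x) (-1) ∂q = 1 - ∫ x, ℓ (g x) 1 ∂q := by
  have hi : Integrable (fun x => ℓ (g x) 1) q :=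
    integrable_of_abs_le (B := 1) ((hc 1).measurable.comp hg) fun z =>
      abs_le.2 ⟨by linarith [h0 (g z) 1], h1 _ _⟩
  have : ∀ x, ℓ (g x) (-1) = 1 - ℓ (g x) 1 := fun x => by linarith [hsymm (g x)]
  simp only [this]
  rw [integral_sub (integrable_const _) hi]
  simp

/-- Under the marginal, the loss against `-1` contains the wanted negative part plus `π E₊[ℓ(g, -1)]
= π - π E₊[ℓ(g, 1)]`; removing the excess doubles the positive weight and leaves the constant `-π`.
The factor `1 *` matches the two-sample form. -/
theorem risk_eq_pu (hsymm : ∀ t, ℓ t 1 + ℓ t (-1) = 1) {g : Input d → ℝ} (hg : Measurable g) :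
    risk P ℓ g = -classPrior P + 2 * classPrior P * ∫ x, ℓ (g x) 1 ∂(condMarginal P 1) +
      1 * ∫ x, ℓ (g x) (-1) ∂(marginal P) := by
  have := isProbabilityMeasure_condMarginal (P := P) (y := 1) hprior0
  rw [risk_eq_pn hprior0 hprior1 h0 h1 hc hg, integral_marginal_eq hprior0 hprior1 h0 h1 hc _ hg,
    integral_loss_neg_one h0 h1 hc hsymm (condMarginal P 1) hg]
  ring

theorem risk_eq_nu (hsymm : ∀ t, ℓ t 1 + ℓ t (-1) = 1) {g : Input d → ℝ} (hg : Measurable g) :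
    risk P ℓ g = -(1 - classPrior P) + 1 * ∫ x, ℓ (g x) 1 ∂(marginal P) +
      2 * (1 - classPrior P) * ∫ x, ℓ (g x) (-1) ∂(condMarginal P (-1)) := by
  have := isProbabilityMeasure_condMarginal (P := P) (y := -1)
    (by rw [measureReal_label_neg_one]; linarith)
  rw [risk_eq_pn hprior0 hprior1 h0 h1 hc hg, integral_marginal_eq hprior0 hprior1 h0 h1 hc _ hg,
    integral_loss_neg_one h0 h1 hc hsymm (condMarginal P (-1)) hg]
  ring

omit h1 hc in
theorem estimationErrorBounds_of_rademacherCondition (hsymm : ∀ t, ℓ t 1 + ℓ t (-1) = 1) {L : ℝ≥0}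
    (hLip : ∀ y, LipschitzWith L fun t => ℓ t y) {G : Set (Input d → ℝ)} (hG : MeasurableClass G)
    {C : ℝ} (hC : 0 ≤ C) (hR : RademacherCondition P G C) : EstimationErrorBounds P ℓ L G C := by
  intro nP nN nU hnP hnN hnU δ hδ gstar hgstar
  have h1 : ∀ t y, ℓ t y ≤ 1 := fun t y => by
    rcases Int.units_eq_one_or y with rfl | rfl
    · linarith [hsymm t, h0 t (-1)]
    · linarith [hsymm t, h0 t 1]
  have hc : ∀ y, Continuous fun t => ℓ t y := fun y => (hLip y).continuous
  have hP := isProbabilityMeasure_condMarginal (P := P) (y := 1) hprior0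
  have hN := isProbabilityMeasure_condMarginal (P := P) (y := -1)
    (by rw [measureReal_label_neg_one]; linarith)
  have hm := hG.measurable_mem
  have rU := hR nU hnU (marginal P) (by simp [marginals])
  have rP := hR nP hnP (condMarginal P 1) (by simp [marginals])
  have rN := hR nN hnN (condMarginal P (-1)) (by simp [marginals])
  have hneg : 0 ≤ 1 - classPrior P := by linarith
  refine ⟨?_, ?_, ?_⟩
  · exact holdsWithProb_two_sample hG h0 h1 hLip hC hnP hnN rP rN 1 (-1) (c := 0) hprior0.le hneg
      (fun g hg => by rw [zero_add, risk_eq_pn hprior0 hprior1 h0 h1 hc (hm g hg)])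
      (fun x₁ x₂ g => by rw [zero_add]; rfl) hgstar.1 hδ
  · exact holdsWithProb_two_sample hG h0 h1 hLip hC hnP hnU rP rU 1 (-1) (by positivity)
      zero_le_one (fun g hg => risk_eq_pu hprior0 hprior1 h0 h1 hc hsymm (hm g hg))
      (fun x₁ x₂ g => by rw [one_mul]; rfl) hgstar.1 hδ
  · exact holdsWithProb_two_sample hG h0 h1 hLip hC hnU hnN rU rN 1 (-1) zero_le_one
      (by positivity) (fun g hg => risk_eq_nu hprior0 hprior1 h0 h1 hc hsymm (hm g hg))
      (fun x₁ x₂ g => by rw [one_mul]; rfl) hgstar.1 hδ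

end Risk

/-! ### Hyperplanes in a Hilbert space: complexity and measurability -/

section Hyperplanes

variable {H : Type u} [NormedAddCommGroup H] [InnerProductSpace ℝ H] {φ : Input d → H}

/-- Flipping the sign at `i` alone negates every term. -/
theorem sum_label_mul_eq_zero {n : ℕ} {i j : Fin n} (hij : i ≠ j) :
    ∑ σ : Fin n → Label, ((σ i : ℤ) : ℝ) * ((σ j : ℤ) : ℝ) = 0 := by
  have h : ∑ σ : Fin n → Label, ((σ i : ℤ) : ℝ) * ((σ j : ℤ) : ℝ) =
      ∑ σ : Fin n → Label, -(((σ i : ℤ) : ℝ) * ((σ j : ℤ) : ℝ)) :=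
    Fintype.sum_equiv (Equiv.mulRight (Function.update (1 : Fin n → Label) i (-1))) _ _ fun σ => by
      simp [Function.update_of_ne hij.symm]
  rw [Finset.sum_neg_distrib] at h
  linarith

theorem sum_norm_sq_label_sum {n : ℕ} (v : Fin n → H) :
    ∑ σ : Fin n → Label, ‖∑ i, ((σ i : ℤ) : ℝ) • v i‖ ^ 2 = 2 ^ n * ∑ i, ‖v i‖ ^ 2 := by
  have h : ∀ σ : Fin n → Label, ‖∑ i, ((σ i : ℤ) : ℝ) • v i‖ ^ 2 =
      ∑ i, ∑ j, ((σ i : ℤ) : ℝ) * ((σ j : ℤ) : ℝ) * inner ℝ (v i) (v j) := fun σ => by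
    rw [← real_inner_self_eq_norm_sq, sum_inner]
    refine Finset.sum_congr rfl fun i _ => ?_
    rw [inner_sum]
    refine Finset.sum_congr rfl fun j _ => ?_
    rw [real_inner_smul_left, real_inner_smul_right, mul_assoc]
  simp only [h]
  rw [Finset.sum_comm, Finset.mul_sum]
  refine Finset.sum_congr rfl fun i _ => ?_
  rw [Finset.sum_comm, Finset.sum_eq_single i]
  · have hs : ∀ s : Label, ((s : ℤ) : ℝ) * ((s : ℤ) : ℝ) = 1 := fun s => by
      rcases Int.units_eq_one_or s with rfl | rfl <;> simp
    simp [hs]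
  · intro j _ hj
    rw [← Finset.sum_mul, sum_label_mul_eq_zero hj.symm, zero_mul]
  · simp

/-- Cauchy–Schwarz passes from the mean norm to the mean square, where orthogonality of the signs
leaves only `∑ ‖v i‖²`. -/
theorem avg_norm_label_sum_le {n : ℕ} (v : Fin n → H) {B : ℝ} (hB : 0 ≤ B)
    (hv : ∀ i, ‖v i‖ ≤ B) :
    (1 / 2 ^ n : ℝ) * ∑ σ : Fin n → Label, ‖∑ i, ((σ i : ℤ) : ℝ) • v i‖ ≤ √n * B := by
  have hsq : ∑ i, ‖v i‖ ^ 2 ≤ n * B ^ 2 := by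
    refine (Finset.sum_le_sum fun i _ => pow_le_pow_left₀ (norm_nonneg _) (hv i) 2).trans ?_
    simp
  have hcs := sq_sum_le_card_mul_sum_sq (s := (Finset.univ : Finset (Fin n → Label)))
    (f := fun σ => ‖∑ i, ((σ i : ℤ) : ℝ) • v i‖)
  rw [sum_norm_sq_label_sum] at hcs
  have hcard : ((Finset.univ : Finset (Fin n → Label)).card : ℝ) = 2 ^ n := by simp
  rw [hcard] at hcs
  have h2 : (0 : ℝ) < 2 ^ n := by positivity
  rw [one_div, inv_mul_le_iff₀ h2]
  refine le_of_sq_le_sq ?_ (by positivity)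
  rw [mul_pow, mul_pow, Real.sq_sqrt (Nat.cast_nonneg n)]
  calc _ ≤ _ := hcs
    _ ≤ 2 ^ n * (2 ^ n * (n * B ^ 2)) := by gcongr
    _ = _ := by ring

theorem empRademacher_hyperplaneClass_le {Cw Cφ : ℝ} (hw : 0 ≤ Cw) (hφ0 : 0 ≤ Cφ)
    (hφ : ∀ x, ‖φ x‖ ≤ Cφ) {n : ℕ} (hn : 0 < n) (x : Fin n → Input d) :
    empRademacher (hyperplaneClass φ Cw) x ≤ ((Cw * Cφ / √n : ℝ) : EReal) := by
  have hn' : (0 : ℝ) < n := by exact_mod_cast hn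
  have hsup : ∀ σ : Fin n → Label,
      (⨆ g ∈ hyperplaneClass φ Cw,
        (((1 / (n : ℝ)) * ∑ i, ((σ i : ℤ) : ℝ) * g (x i) : ℝ) : EReal)) ≤
      ((Cw / n * ‖∑ i, ((σ i : ℤ) : ℝ) • φ (x i)‖ : ℝ) : EReal) := by
    intro σ
    refine iSup₂_le ?_
    rintro _ ⟨w, hwn, rfl⟩
    rw [EReal.coe_le_coe_iff]
    have : ∑ i, ((σ i : ℤ) : ℝ) * inner ℝ w (φ (x i)) =
        inner ℝ w (∑ i, ((σ i : ℤ) : ℝ) • φ (x i)) := by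
      rw [inner_sum]
      exact Finset.sum_congr rfl fun i _ => (real_inner_smul_right _ _ _).symm
    rw [this, div_mul_eq_mul_div Cw, one_div, ← div_eq_inv_mul]
    gcongr
    exact (real_inner_le_norm _ _).trans (by gcongr)
  calc empRademacher (hyperplaneClass φ Cw) x
      ≤ ((1 / 2 ^ n : ℝ) : EReal) * ∑ σ : Fin n → Label,
          ((Cw / n * ‖∑ i, ((σ i : ℤ) : ℝ) • φ (x i)‖ : ℝ) : EReal) :=
        mul_le_mul_of_nonneg_left (Finset.sum_le_sum fun σ _ => hsup σ)
          (EReal.coe_nonneg.2 (by positivity))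
    _ = (((1 / 2 ^ n : ℝ) * ∑ σ : Fin n → Label,
          (Cw / n * ‖∑ i, ((σ i : ℤ) : ℝ) • φ (x i)‖) : ℝ) : EReal) := by
        rw [EReal.coe_mul, EReal.coe_finset_sum]
    _ ≤ _ := by
        rw [EReal.coe_le_coe_iff, ← Finset.mul_sum, mul_left_comm]
        calc _ ≤ Cw / n * (√n * Cφ) := by
              exact mul_le_mul_of_nonneg_left
                (avg_norm_label_sum_le _ hφ0 fun i => hφ (x i)) (by positivity)
          _ = _ := by
              rw [eq_div_iff (by positivity)]
              have := Real.mul_self_sqrt hn'.le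
              field_simp
              linear_combination Cw * Cφ * this

theorem rademacher_hyperplaneClass_le {Cw Cφ : ℝ} (hw : 0 ≤ Cw) (hφ0 : 0 ≤ Cφ)
    (hφ : ∀ x, ‖φ x‖ ≤ Cφ) {n : ℕ} (hn : 0 < n) (q : Measure (Input d)) [IsProbabilityMeasure q] :
    rademacher n q (hyperplaneClass φ Cw) ≤ ENNReal.ofReal (Cw * Cφ / √n) := by
  calc _ ≤ ∫⁻ _, ENNReal.ofReal (Cw * Cφ / √n) ∂(sampleLaw q n) := lintegral_mono fun x => by
        rw [← EReal.real_coe_toENNReal]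
        exact EReal.toENNReal_le_toENNReal (empRademacher_hyperplaneClass_le hw hφ0 hφ hn x)
    _ = _ := by simp

variable [CompleteSpace H]

/-- The closed span of the range of a strongly measurable map contains a countable set that is dense
in the ball of radius `r`, as far as inner products with the range are concerned. -/
theorem exists_countable_dense_normals (hφ : StronglyMeasurable φ) (r : ℝ) :
    ∃ D : Set H, D.Countable ∧ (∀ w ∈ D, ‖w‖ ≤ r) ∧ ∀ w, ‖w‖ ≤ r →
      ∃ w' ∈ closure D, ∀ x, inner ℝ w' (φ x) = inner ℝ w (φ x) := by
  set S : Submodule ℝ H := (Submodule.span ℝ (Set.range φ)).topologicalClosure with hS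
  have hsep : TopologicalSpace.IsSeparable (S : Set H) := by
    rw [hS, Submodule.topologicalClosure_coe]
    exact (hφ.isSeparable_range.span (R := ℝ)).closure
  have : CompleteSpace S :=
    (Submodule.isClosed_topologicalClosure _).completeSpace_coe
  obtain ⟨D, hD, hDc, hDd⟩ :=
    (hsep.mono (Set.inter_subset_left (t := {w | ‖w‖ ≤ r}))).exists_countable_dense_subset
  -- Projecting `w` onto the closed span keeps its inner products with every `φ x` and does not
  -- increase its norm; `H` itself need not be separable.
  refine ⟨D, hDc, fun w hw => (hD hw).2, fun w hw => ⟨S.starProjection w, hDd ⟨?_, ?_⟩, fun x => ?_⟩⟩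
  · exact S.starProjection_apply_mem w
  · exact (S.norm_starProjection_apply_le w).trans hw
  · have hx : φ x ∈ S := Submodule.le_topologicalClosure _ (Submodule.subset_span ⟨x, rfl⟩)
    rw [S.inner_starProjection_left_eq_right, Submodule.starProjection_eq_self_iff.2 hx]

theorem measurableClass_hyperplaneClass (hφ : StronglyMeasurable φ) (Cw : ℝ) :
    MeasurableClass (hyperplaneClass φ Cw) where
  measurable_mem := by
    rintro _ ⟨w, -, rfl⟩
    exact (stronglyMeasurable_const.inner hφ).measurable
  measurableSet_hit n U hU := by
    obtain ⟨D, hDc, hDr, hD⟩ := exists_countable_dense_normals hφ Cw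
    have : {x : Fin n → Input d | ∃ g ∈ hyperplaneClass φ Cw, (fun i => g (x i)) ∈ U} =
        ⋃ w ∈ D, {x | (fun i => inner ℝ w (φ (x i))) ∈ U} := by
      ext x
      simp only [Set.mem_ofPred_eq, Set.mem_iUnion, exists_prop]
      constructor
      · rintro ⟨_, ⟨w, hw, rfl⟩, hx⟩
        obtain ⟨w', hw', heq⟩ := hD w hw
        have hopen : IsOpen {v : H | (fun i => inner ℝ v (φ (x i))) ∈ U} :=
          hU.preimage (by fun_prop)
        -- Openness of `U` allows a small perturbation of the normal into `D`, so a countable union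
        -- suffices.
        obtain ⟨v, hv, hvD⟩ := mem_closure_iff.1 hw' _ hopen (by simpa only [Set.mem_ofPred_eq, heq])
        exact ⟨v, hvD, hv⟩
      · rintro ⟨w, hw, hx⟩
        exact ⟨_, ⟨w, hDr w hw, rfl⟩, hx⟩
    rw [this]
    refine .biUnion hDc fun w _ => ?_
    have hm : Measurable fun x => inner ℝ w (φ x) :=
      (stronglyMeasurable_const.inner hφ).measurable
    exact (measurable_pi_lambda _ fun i => hm.comp (measurable_pi_apply i)) hU.measurableSet

end Hyperplanes

end PUComparison

end

theorem corollary1 {d : ℕ}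
    (P : Measure (PUComparison.Input d × PUComparison.Label)) [IsProbabilityMeasure P]
    (hprior0 : 0 < PUComparison.classPrior P) (hprior1 : PUComparison.classPrior P < 1)
    (ℓ : ℝ → PUComparison.Label → ℝ) (hnonneg : ∀ t y, 0 ≤ ℓ t y)
    (hsymm : ∀ t, ℓ t 1 + ℓ t (-1) = 1)
    (L : ℝ≥0) (hLip : ∀ y, LipschitzWith L (fun t => ℓ t y)) :
    (∀ G : Set (PUComparison.Input d → ℝ), PUComparison.MeasurableClass G →
      ∀ CG : ℝ, 0 < CG → PUComparison.RademacherCondition P G CG →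
        PUComparison.EstimationErrorBounds P ℓ L G CG) ∧
    (∀ (H : Type u) [NormedAddCommGroup H] [InnerProductSpace ℝ H] [CompleteSpace H]
      (φ : PUComparison.Input d → H), StronglyMeasurable φ →
      ∀ Cw Cφ : ℝ, 0 < Cw → 0 < Cφ → (∀ x, ‖φ x‖ ≤ Cφ) →
        PUComparison.RademacherCondition P (PUComparison.hyperplaneClass φ Cw) (Cw * Cφ) ∧
        PUComparison.EstimationErrorBounds P ℓ L (PUComparison.hyperplaneClass φ Cw) (Cw * Cφ)) := by
  refine ⟨fun G hG CG hCG hR => PUComparison.estimationErrorBounds_of_rademacherCondition hprior0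
    hprior1 hnonneg hsymm hLip hG hCG.le hR, ?_⟩
  intro H _ _ _ φ hφ Cw Cφ hCw hCφ hbound
  have hR : PUComparison.RademacherCondition P (PUComparison.hyperplaneClass φ Cw) (Cw * Cφ) := by
    intro n hn q hq
    have : IsProbabilityMeasure q := by
      rcases hq with rfl | rfl | rfl
      · infer_instance
      · exact PUComparison.isProbabilityMeasure_condMarginal hprior0
      · refine PUComparison.isProbabilityMeasure_condMarginal ?_
        rw [PUComparison.measureReal_label_neg_one]
        linarith
    exact PUComparison.rademacher_hyperplaneClass_le hCw.le hCφ.le hbound hn q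
  exact ⟨hR, PUComparison.estimationErrorBounds_of_rademacherCondition hprior0 hprior1 hnonneg hsymm
    hLip (PUComparison.measurableClass_hyperplaneClass hφ Cw) (mul_pos hCw hCφ).le hR⟩
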